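/- Let $(M,T_{1,0}(M))$ be a strictly pseudoconvex CR manifold of dimension $2n+1$ (hypersurface type, CR dimension $n$), with Levi distribution $H(M)$ and complex structure $J$ on it, and let $\theta$ be a contact form ($\operatorname{Ker}\theta=H(M)$) whose Levi form $G_\theta(X,Y)=(d\theta)(X,JY)$, $X,Y\in H(M)$, is positive definite; here $2(d\theta)(X,Y)=X(\theta(Y))-Y(\theta(X))-\theta([X,Y])$. Let $T$ be the characteristic direction ($\theta(T)=1$, $T\rfloor d\theta=0$), extend $J$ by $JT=0$, and let $g_\theta$ be the Webster metric: $g_\theta=G_\theta$ on $H(M)$, $g_\theta(X,T)=0$ for $X\in H(M)$, $g_\theta(T,T)=1$. Let $\nabla$ be the Tanaka–Webster connection of $(M,\theta)$, that is, the linear connection for which $H(M)$ is parallel, $\nabla g_\theta=0$, $\nabla J=0$, and whose torsion $T_\nabla$ satisfies $T_\nabla(Z,W)=T_\nabla(\overline Z,\overline W)=0$ and $T_\nabla(Z,\overline W)=2iL_\theta(Z,\overline W)T$ for $Z,W\in T_{1,0}(M)$, where $L_\theta(Z,\overline W)=-i(d\theta)(Z,\overline W)$, and $\tau\circ J+J\circ\tau=0$,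 where $\tau(X)=T_\nabla(T,X)$. For a curve $\gamma:[a,b]\to M$ let $L(\gamma)=\int_a^b g_\theta(\dot\gamma,\dot\gamma)^{1/2}\,dt$. (1) Let $a<b$, $\epsilon>0$, and let $\gamma^s:[a,b]\to M$, $|s|<\epsilon$, be a one-parameter family of curves such that $(t,s)\mapsto\gamma^s(t)$ is $C^\infty$ on $[a,b]\times(-\epsilon,\epsilon)$ and each $\gamma^s$ is parametrized proportionally to arc length (the $g_\theta$-length of $\dot\gamma^s(t)$ does not depend on $t$). Set $\gamma=\gamma^0$, let $X_{\gamma(t)}=\frac{\partial}{\partial s}\gamma^s(t)\big|_{s=0}$, let $r=|\dot\gamma(t)|$ be the common length of the tangent vectors of $\gamma$, and assume $r>0$. Then $s\mapsto L(\gamma^s)$ is differentiable at $0$ and $$\frac{d}{ds}\{L(\gamma^s)\}_{s=0}=\frac1r\Big\{g_\theta(X,\dot\gamma)_{\gamma(b)}-g_\theta(X,\dot\gamma)_{\gamma(a)}-\int_a^b\big[g_\theta(X,\nabla_{\dot\gamma}\dot\gamma)-g_\theta(T_\nabla(X,\dot\gamma),\dot\gamma)\big]_{\gamma(t)}\,dt\Big\}.$$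 (2) Suppose in addition that $(M,\theta)$ is a Sasakian manifold, that is, the contact metric structure $(\varphi,\xi,\eta,g)=(J,-T,-\theta,g_\theta)$ is normal: $[\varphi,\varphi]+2(d\eta)\otimes\xi=0$. Let $a<b$, $y,z\in M$, and let $\Gamma$ be the set of all piecewise smooth curves $[a,b]\to M$ from $y$ to $z$ parametrized proportionally to arc length. If a nonconstant curve $\gamma\in\Gamma$ is a lengthy ($\dot\gamma\in H(M)$) geodesic of $\nabla$ ($\nabla_{\dot\gamma}\dot\gamma=0$), then $\gamma$ is a critical point of $L$ on $\Gamma$: $\frac{d}{ds}\{L(\gamma^s)\}_{s=0}=0$ for every family $\gamma^s\in\Gamma$, $|s|<\epsilon$, with $\gamma^0=\gamma$, for which there is a partition $a=t_0<\dots<t_k=b$ such that $(t,s)\mapsto\gamma^s(t)$ is smooth on each rectangle $[t_j,t_{j+1}]\times(-\epsilon,\epsilon)$. -/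

import Mathlib

open Set Filter Topology Bundle VectorField FiberBundle
open scoped Manifold ContDiff

noncomputable section

namespace CR

/-! ## Vector fields, and the exterior derivative of a 1-form

`M` is a smooth manifold without boundary modelled on a finite-dimensional real vector space `E`. -/

section Basics

variable {E : Type*} [NormedAddCommGroup E] [NormedSpace ℝ E]
  {M : Type*} [TopologicalSpace M] [ChartedSpace E M]

variable (E M) in
/-- Vector fields on `M` (no regularity required). -/
abbrev VF := Π x : M, TangentSpace 𝓘(ℝ, E) x

variable (E M) in
/-- Real 1-forms on `M` (no regularity required). -/
abbrev OneForm := Π x : M, TangentSpace 𝓘(ℝ, E) x →L[ℝ] ℝ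

variable (E M) in
/-- Fields of endomorphisms of the tangent bundle of `M` (no regularity required). -/
abbrev EndField := Π x : M, TangentSpace 𝓘(ℝ, E) x →L[ℝ] TangentSpace 𝓘(ℝ, E) x

/-- The vector field `J X`. -/
def EndField.app (J : EndField E M) (X : VF E M) : VF E M := fun y ↦ J y (X y)

/-- The function `θ(X)`. -/
def OneForm.app (θ : OneForm E M) (X : VF E M) : M → ℝ := fun y ↦ θ y (X y)

/-- `½ (X(θ(Y)) - Y(θ(X)) - θ([X, Y]))` at `x`. -/
def dAux (θ : OneForm E M) (x : M) (X Y : VF E M) : ℝ :=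
  (1 / 2) * (mvfderiv 𝓘(ℝ, E) (θ.app Y) x (X x) - mvfderiv 𝓘(ℝ, E) (θ.app X) x (Y x)
    - θ x (mlieBracket 𝓘(ℝ, E) X Y x))

lemma dAux_swap (θ : OneForm E M) (x : M) (X Y : VF E M) : dAux θ x X Y = - dAux θ x Y X := by
  unfold dAux
  rw [mlieBracket_swap_apply, map_neg]
  ring

variable [IsManifold 𝓘(ℝ, E) ∞ M]

/-- The vector field `X` is `C^∞` at `x` (hence `C^k` near `x` for every finite `k`). -/
def SmoothVFAt (X : VF E M) (x : M) : Prop :=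
  ContMDiffAt 𝓘(ℝ, E) (𝓘(ℝ, E).prod 𝓘(ℝ, E)) ∞ (fun y ↦ TotalSpace.mk' E y (X y)) x

/-- The 1-form `θ` is `C^∞`. -/
def SmoothOneForm (θ : OneForm E M) : Prop :=
  ContMDiff 𝓘(ℝ, E) (𝓘(ℝ, E).prod 𝓘(ℝ, E →L[ℝ] ℝ)) ∞
    (fun y ↦ TotalSpace.mk' (E →L[ℝ] ℝ) y (θ y))

/-- The field of endomorphisms `J` is `C^∞`. -/
def SmoothEndField (J : EndField E M) : Prop :=
  ContMDiff 𝓘(ℝ, E) (𝓘(ℝ, E).prod 𝓘(ℝ, E →L[ℝ] E)) ∞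
    (fun y ↦ TotalSpace.mk' (E →L[ℝ] E) y (J y))

lemma SmoothOneForm.mdifferentiableAt_app {θ : OneForm E M} (hθ : SmoothOneForm θ)
    {X : VF E M} {x : M} (hX : MDiffAt (T% X) x) : MDiffAt (θ.app X) x := by
  have h1 : MDifferentiableAt 𝓘(ℝ, E) (𝓘(ℝ, E).prod 𝓘(ℝ, E →L[ℝ] ℝ))
      (fun y ↦ TotalSpace.mk' (E →L[ℝ] ℝ) (E := fun y : M ↦ TangentSpace 𝓘(ℝ, E) y →L[ℝ] ℝ)
        y (θ y)) x := (hθ x).mdifferentiableAt (by simp)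
  have h2 : MDifferentiableAt 𝓘(ℝ, E) (𝓘(ℝ, E).prod 𝓘(ℝ, ℝ))
      (fun y ↦ TotalSpace.mk' ℝ (E := Bundle.Trivial M ℝ) y (θ y (X y))) x :=
    MDifferentiableAt.clm_bundle_apply (F₁ := E) (F₂ := ℝ) h1 hX
  simp only [mdifferentiableAt_totalSpace] at h2
  exact h2.2

variable [CompleteSpace E]

lemma dAux_tensorial₂ {θ : OneForm E M} (hθ : SmoothOneForm θ) (x : M) (X : VF E M)
    (_hX : MDiffAt (T% X) x) : TensorialAt 𝓘(ℝ, E) E (dAux θ x X) x where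
  smul {f Y} hf hY := by
    have h1 : θ.app (f • Y) = f * θ.app Y := by ext y; simp [OneForm.app]
    have hY' := hθ.mdifferentiableAt_app hY
    unfold dAux
    rw [mlieBracket_smul_right hf hY, h1, mvfderiv_mul hf hY']
    simp [OneForm.app]
    ring
  add {Y Y'} hY hY' := by
    have h1 : θ.app (Y + Y') = θ.app Y + θ.app Y' := by ext y; simp [OneForm.app]
    have h2 := hθ.mdifferentiableAt_app hY
    have h3 := hθ.mdifferentiableAt_app hY'
    unfold dAux
    rw [mlieBracket_add_right hY hY', h1, mvfderiv_add h2 h3]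
    simp
    ring

lemma dAux_tensorial₁ {θ : OneForm E M} (hθ : SmoothOneForm θ) (x : M) (Y : VF E M)
    (hY : MDiffAt (T% Y) x) : TensorialAt 𝓘(ℝ, E) E (fun X ↦ dAux θ x X Y) x where
  smul {f X} hf hX := by
    rw [dAux_swap, dAux_swap θ x X, (dAux_tensorial₂ hθ x Y hY).smul hf hX]
    simp
  add {X X'} hX hX' := by
    rw [dAux_swap, dAux_swap θ x X, dAux_swap θ x X', (dAux_tensorial₂ hθ x Y hY).add hX hX']
    ring

variable [FiniteDimensional ℝ E]

/-- The exterior derivative of a smooth 1-form, normalized by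
`2 (dθ)(X, Y) = X(θ(Y)) - Y(θ(X)) - θ([X, Y])`. This normalization is the one for which the
purity condition `T_∇(Z, W̄) = 2 i L_θ(Z, W̄) T`, `L_θ = -i dθ`, of the Tanaka-Webster connection
and the contact condition `Ω = dη` hold. -/
def extD {θ : OneForm E M} (hθ : SmoothOneForm θ) (x : M) :
    TangentSpace 𝓘(ℝ, E) x →L[ℝ] TangentSpace 𝓘(ℝ, E) x →L[ℝ] ℝ :=
  TensorialAt.mkHom₂ (dAux θ x) x (dAux_tensorial₁ hθ x) (dAux_tensorial₂ hθ x)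

theorem extD_apply {θ : OneForm E M} (hθ : SmoothOneForm θ) (x : M) {X Y : VF E M}
    (hX : MDiffAt (T% X) x) (hY : MDiffAt (T% Y) x) :
    extD hθ x (X x) (Y x) =
      (1 / 2) * (mvfderiv 𝓘(ℝ, E) (θ.app Y) x (X x) - mvfderiv 𝓘(ℝ, E) (θ.app X) x (Y x)
        - θ x (mlieBracket 𝓘(ℝ, E) X Y x)) :=
  TensorialAt.mkHom₂_apply _ _ hX hY

end Basics

/-! ## Complexification

An element `u + i v` of `V ⊗ ℂ` is written as the pair `(u, v) : V × V`. -/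

section Complexification

variable {V W : Type*} [AddCommGroup V] [AddCommGroup W]

/-- Complex conjugation on `V ⊗ ℂ`. -/
def conjC (Z : V × V) : V × V := (Z.1, -Z.2)

/-- The extension of a real bilinear `B : V × V → W` to a complex bilinear map
`(V ⊗ ℂ) × (V ⊗ ℂ) → W ⊗ ℂ`:
`B(u + i v, u' + i v') = B(u, u') - B(v, v') + i (B(u, v') + B(v, u'))`. -/
def extC (B : V → V → W) (Z Z' : V × V) : W × W :=
  (B Z.1 Z'.1 - B Z.2 Z'.2, B Z.1 Z'.2 + B Z.2 Z'.1)

/-- The same for a real valued bilinear map, the result being a complex number. -/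
def extCℂ (B : V → V → ℝ) (Z Z' : V × V) : ℂ :=
  ⟨(extC B Z Z').1, (extC B Z Z').2⟩

/-- `c • u` in `V ⊗ ℂ` for a complex scalar `c` and a real vector `u`. -/
def smulC [Module ℝ V] (c : ℂ) (u : V) : V × V := (c.re • u, c.im • u)

end Complexification

/-! ## Strictly pseudoconvex pseudohermitian manifolds -/

section Pseudohermitian

variable {E : Type*} [NormedAddCommGroup E] [NormedSpace ℝ E]
  {M : Type*} [TopologicalSpace M] [ChartedSpace E M]

/-- `T_{1,0}(M)_x = { u - i J u : u ∈ Ker θ_x }`, the space of vectors of type `(1, 0)`. -/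
def T10 (θ : OneForm E M) (J : EndField E M) (x : M) :
    Set (TangentSpace 𝓘(ℝ, E) x × TangentSpace 𝓘(ℝ, E) x) :=
  {Z | θ x Z.1 = 0 ∧ Z.2 = - J x Z.1}

variable [IsManifold 𝓘(ℝ, E) ∞ M] [FiniteDimensional ℝ E] [CompleteSpace E]

variable (E M) in
/-- A strictly pseudoconvex CR manifold (of hypersurface type) `(M, T_{1,0}(M))` with a contact
form `θ` whose Levi form is positive definite.

The CR structure is given by its Levi distribution `H(M) = Ker θ` with the complex structure `J`,
i.e. `T_{1,0}(M) = { X - i J X : X ∈ H(M) }`. As usual `J` is extended to the tangent bundle by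
`J T = 0`, where `T` is the characteristic direction, the (unique) vector field with `θ(T) = 1` and
`T ⌟ dθ = 0`. The existence of `J` forces `dim M = 2 n + 1`, where `n` is the complex rank of
`T_{1,0}(M)`. -/
structure PseudohermitianManifold where
  /-- the contact form -/
  θ : OneForm E M
  /-- the complex structure of the Levi distribution, extended by `J T = 0` -/
  J : EndField E M
  /-- the characteristic direction of `dθ` -/
  T : VF E M
  smooth_θ : SmoothOneForm θ
  smooth_J : SmoothEndField J
  smooth_T : ∀ x, SmoothVFAt T x
  /-- `J` maps `H(M)` to itself and is a complex structure there -/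
  θ_J : ∀ x u, θ x u = 0 → θ x (J x u) = 0
  J_J : ∀ x u, θ x u = 0 → J x (J x u) = - u
  J_T : ∀ x, J x (T x) = 0
  θ_T : ∀ x, θ x (T x) = 1
  T_contract_dθ : ∀ x u, extD smooth_θ x (T x) u = 0
  /-- formal integrability: the bracket of two local sections `Z`, `W` of `T_{1,0}(M)` is again
  a section of `T_{1,0}(M)` -/
  integrable : ∀ (x : M) (Z W : VF E M × VF E M),
    SmoothVFAt Z.1 x → SmoothVFAt Z.2 x → SmoothVFAt W.1 x → SmoothVFAt W.2 x →
    (∀ᶠ y in 𝓝 x, (Z.1 y, Z.2 y) ∈ T10 θ J y) → (∀ᶠ y in 𝓝 x, (W.1 y, W.2 y) ∈ T10 θ J y) →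
    extC (fun X Y : VF E M ↦ mlieBracket 𝓘(ℝ, E) X Y x) Z W ∈ T10 θ J x
  /-- the real Levi form `G_θ(X, Y) = dθ(X, J Y)` is positive definite on `H(M)` -/
  pos : ∀ x u, θ x u = 0 → u ≠ 0 → 0 < extD smooth_θ x u (J x u)

namespace PseudohermitianManifold

variable (P : PseudohermitianManifold E M)

/-- The exterior derivative of the contact form. -/
def dθ (x : M) : TangentSpace 𝓘(ℝ, E) x →L[ℝ] TangentSpace 𝓘(ℝ, E) x →L[ℝ] ℝ :=
  extD P.smooth_θ x

/-- The Webster metric `g_θ`. See `g_of_mem_H`, `g_T_right`, `g_T_left` and `g_T_T` below. -/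
def g (x : M) (u v : TangentSpace 𝓘(ℝ, E) x) : ℝ :=
  P.dθ x u (P.J x v) + P.θ x u * P.θ x v

lemma g_of_mem_H (x : M) (u v : TangentSpace 𝓘(ℝ, E) x) (hu : P.θ x u = 0) :
    P.g x u v = P.dθ x u (P.J x v) := by simp [g, hu]

lemma g_T_right (x : M) (u : TangentSpace 𝓘(ℝ, E) x) (hu : P.θ x u = 0) :
    P.g x u (P.T x) = 0 := by simp [g, hu, P.J_T]

lemma g_T_left (x : M) (u : TangentSpace 𝓘(ℝ, E) x) (hu : P.θ x u = 0) :
    P.g x (P.T x) u = 0 := by simp [g, hu, dθ, P.T_contract_dθ]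

lemma g_T_T (x : M) : P.g x (P.T x) (P.T x) = 1 := by simp [g, P.J_T, P.θ_T]

/-- The Levi form `L_θ(Z, W̄) = - i (dθ)(Z, W̄)`. -/
def levi (x : M) (Z W : TangentSpace 𝓘(ℝ, E) x × TangentSpace 𝓘(ℝ, E) x) : ℂ :=
  - Complex.I * extCℂ (fun u v ↦ P.dθ x u v) Z (conjC W)

/-- `(M, θ)` is a Sasakian manifold: the contact metric structure
`(φ, ξ, η, g) = (J, -T, -θ, g_θ)` is normal, i.e. `[φ, φ] + 2 (dη) ⊗ ξ = 0`, where
`[φ, φ](X, Y) = φ²[X, Y] + [φ X, φ Y] - φ [φ X, Y] - φ [X, φ Y]`. -/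
def IsSasakian : Prop :=
  ∀ (x : M) (X Y : VF E M), SmoothVFAt X x → SmoothVFAt Y x →
    P.J x (P.J x (mlieBracket 𝓘(ℝ, E) X Y x))
      + mlieBracket 𝓘(ℝ, E) (P.J.app X) (P.J.app Y) x
      - P.J x (mlieBracket 𝓘(ℝ, E) (P.J.app X) Y x)
      - P.J x (mlieBracket 𝓘(ℝ, E) X (P.J.app Y) x)
      + (2 * (- P.dθ x (X x) (Y x))) • (- P.T x) = 0

variable (E M) in
/-- Linear connections on `M`. Mathlib writes `∇ Y x u` for `(∇_u Y)_x`. -/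
abbrev LinearConnection := CovariantDerivative 𝓘(ℝ, E) E (TangentSpace 𝓘(ℝ, E) : M → Type _)

/-- The pseudohermitian torsion `τ(u) = T_∇(T, u)`. -/
def tau (D : LinearConnection E M) (x : M) (u : TangentSpace 𝓘(ℝ, E) x) :
    TangentSpace 𝓘(ℝ, E) x :=
  D.torsion x (P.T x) u

/-- `D` is the Tanaka-Webster connection of `(M, θ)`: the (unique) smooth linear connection `∇`
such that `H(M)` is parallel, `∇ g_θ = 0`, `∇ J = 0`, and whose torsion `T_∇` is pure. -/
structure IsTanakaWebster (D : LinearConnection E M) : Prop where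
  smooth : CovariantDerivative.ContMDiffCovariantDerivative D ∞
  /-- `X ∈ H(M)` implies `∇_u X ∈ H(M)` -/
  parallel_H : ∀ (x : M) (X : VF E M) (u : TangentSpace 𝓘(ℝ, E) x), SmoothVFAt X x →
    (∀ᶠ y in 𝓝 x, P.θ y (X y) = 0) → P.θ x (D X x u) = 0
  /-- `u(g_θ(X, Y)) = g_θ(∇_u X, Y) + g_θ(X, ∇_u Y)` -/
  parallel_g : ∀ (x : M) (X Y : VF E M) (u : TangentSpace 𝓘(ℝ, E) x),
    SmoothVFAt X x → SmoothVFAt Y x →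
    mvfderiv 𝓘(ℝ, E) (fun y ↦ P.g y (X y) (Y y)) x u
      = P.g x (D X x u) (Y x) + P.g x (X x) (D Y x u)
  /-- `∇_u (J X) = J (∇_u X)` -/
  parallel_J : ∀ (x : M) (X : VF E M) (u : TangentSpace 𝓘(ℝ, E) x), SmoothVFAt X x →
    D (P.J.app X) x u = P.J x (D X x u)
  /-- `T_∇(Z, W) = 0` for `Z, W ∈ T_{1,0}(M)` -/
  pure_holomorphic : ∀ (x : M), ∀ Z ∈ T10 P.θ P.J x, ∀ W ∈ T10 P.θ P.J x,
    extC (fun u v ↦ D.torsion x u v) Z W = 0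
  /-- `T_∇(Z̄, W̄) = 0` for `Z, W ∈ T_{1,0}(M)` -/
  pure_antiholomorphic : ∀ (x : M), ∀ Z ∈ T10 P.θ P.J x, ∀ W ∈ T10 P.θ P.J x,
    extC (fun u v ↦ D.torsion x u v) (conjC Z) (conjC W) = 0
  /-- `T_∇(Z, W̄) = 2 i L_θ(Z, W̄) T` for `Z, W ∈ T_{1,0}(M)` -/
  pure_mixed : ∀ (x : M), ∀ Z ∈ T10 P.θ P.J x, ∀ W ∈ T10 P.θ P.J x,
    extC (fun u v ↦ D.torsion x u v) Z (conjC W)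
      = smulC (2 * Complex.I * P.levi x Z W) (P.T x)
  /-- `τ ∘ J + J ∘ τ = 0` -/
  tau_J : ∀ (x : M) (u : TangentSpace 𝓘(ℝ, E) x),
    P.tau D x (P.J x u) + P.J x (P.tau D x u) = 0

end PseudohermitianManifold

end Pseudohermitian

/-! ## Curves

A curve `[a, b] → M` is given by a function `γ : ℝ → M`, of which only the values on `[a, b]`
matter; derivatives are taken within `[a, b]`, i.e. they are one-sided at the end points. -/

section Curves

variable {E : Type*} [NormedAddCommGroup E] [NormedSpace ℝ E]
  {M : Type*} [TopologicalSpace M] [ChartedSpace E M]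

/-- The tangent vector `γ̇(t)`, the derivative being taken within `S` (and zero if `γ` is not
differentiable at `t` within `S`). -/
def velocity (γ : ℝ → M) (S : Set ℝ) (t : ℝ) : TangentSpace 𝓘(ℝ, E) (γ t) :=
  mfderivWithin 𝓘(ℝ, ℝ) 𝓘(ℝ, E) γ S t (1 : ℝ)

variable [IsManifold 𝓘(ℝ, E) ∞ M]

/-- The covariant derivative `(∇_{γ̇} V)(t₀)` of a vector field `V` along the curve `γ`.

Let `(e_i)` be the local frame given by the trivialization of `T(M)` at `γ(t₀)` and
`V(t) = V^i(t) e_i(γ(t))`. Then `∇_{γ̇} V = (dV^i/dt) e_i + V^i ∇_{γ̇} e_i`. The first summand is the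
first summand below. The second one is, at `t₀`, the derivative in the direction `γ̇(t₀)` of the
vector field `V^i(t₀) e_i` with constant components, which is `extend E (V t₀)`. -/
def covAlong (D : CovariantDerivative 𝓘(ℝ, E) E (TangentSpace 𝓘(ℝ, E) : M → Type _))
    (γ : ℝ → M) (S : Set ℝ) (V : Π t : ℝ, TangentSpace 𝓘(ℝ, E) (γ t)) (t₀ : ℝ) :
    TangentSpace 𝓘(ℝ, E) (γ t₀) :=
  let e := trivializationAt E (TangentSpace 𝓘(ℝ, E) : M → Type _) (γ t₀)
  e.symmL ℝ (γ t₀) (derivWithin (fun t ↦ e.continuousLinearMapAt ℝ (γ t) (V t)) S t₀)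
    + D (extend E (V t₀)) (γ t₀) (velocity γ S t₀)

/-- The acceleration `∇_{γ̇} γ̇`. -/
def accel (D : CovariantDerivative 𝓘(ℝ, E) E (TangentSpace 𝓘(ℝ, E) : M → Type _))
    (γ : ℝ → M) (S : Set ℝ) (t : ℝ) : TangentSpace 𝓘(ℝ, E) (γ t) :=
  covAlong D γ S (fun t ↦ velocity γ S t) t

/-- `γ : [a, b] → M` is a geodesic of the connection `D`. -/
def IsGeodesic (D : CovariantDerivative 𝓘(ℝ, E) E (TangentSpace 𝓘(ℝ, E) : M → Type _))
    (γ : ℝ → M) (a b : ℝ) : Prop :=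
  ContMDiffOn 𝓘(ℝ, ℝ) 𝓘(ℝ, E) 2 γ (Icc a b) ∧ ∀ t ∈ Icc a b, accel D γ (Icc a b) t = 0

/-- `a = p₀ < p₁ < ⋯ < p_k = b`. -/
def IsPartition (a b : ℝ) {k : ℕ} (p : Fin (k + 1) → ℝ) : Prop :=
  p 0 = a ∧ p (Fin.last k) = b ∧ StrictMono p

variable [FiniteDimensional ℝ E] [CompleteSpace E]

namespace PseudohermitianManifold

variable (P : PseudohermitianManifold E M)

/-- The length `|γ̇(t)|` of the tangent vector with respect to the Webster metric. -/
def speed (γ : ℝ → M) (S : Set ℝ) (t : ℝ) : ℝ :=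
  Real.sqrt (P.g (γ t) (velocity γ S t) (velocity γ S t))

/-- The Riemannian length of `γ : [a, b] → M` with respect to the Webster metric. For a piecewise
smooth curve the velocity is the actual one except at finitely many points. -/
def length (γ : ℝ → M) (a b : ℝ) : ℝ := ∫ t in a..b, P.speed γ (Icc a b) t

/-- `γ : [a, b] → M` is lengthy: `γ̇(t) ∈ H(M)` whenever `γ̇(t)` is defined. -/
def IsLengthy (γ : ℝ → M) (a b : ℝ) : Prop :=
  ∀ t ∈ Icc a b, P.θ (γ t) (velocity γ (Icc a b) t) = 0

/-- `γ ∈ Γ`: a piecewise smooth curve `[a, b] → M` from `y` to `z`, parametrized proportionally to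
arc length. -/
def IsInΓ (a b : ℝ) (y z : M) (γ : ℝ → M) : Prop :=
  γ a = y ∧ γ b = z ∧
    ∃ (k : ℕ) (p : Fin (k + 1) → ℝ) (c : ℝ), IsPartition a b p ∧ ∀ j : Fin k,
      ContMDiffOn 𝓘(ℝ, ℝ) 𝓘(ℝ, E) ∞ γ (Icc (p j.castSucc) (p j.succ)) ∧
      ∀ t ∈ Icc (p j.castSucc) (p j.succ),
        P.speed γ (Icc (p j.castSucc) (p j.succ)) t = c

/-- `(γ^s)`, `|s| < ε`, is a variation of `γ` in `Γ`: each `γ^s` is in `Γ`, `γ^0 = γ`, and there is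
a partition of `[a, b]` such that `(t, s) ↦ γ^s(t)` is smooth on each rectangle
`[p_j, p_{j+1}] × (-ε, ε)`. -/
structure IsVariation (a b : ℝ) (y z : M) (γ : ℝ → M) (ε : ℝ) (Φ : ℝ → ℝ → M) : Prop where
  pos : 0 < ε
  mem : ∀ s ∈ Ioo (-ε) ε, P.IsInΓ a b y z (Φ s)
  base : ∀ t ∈ Icc a b, Φ 0 t = γ t
  smooth : ∃ (k : ℕ) (p : Fin (k + 1) → ℝ), IsPartition a b p ∧ ∀ j : Fin k,
    ContMDiffOn 𝓘(ℝ, ℝ × ℝ) 𝓘(ℝ, E) ∞ (fun q : ℝ × ℝ ↦ Φ q.2 q.1)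
      (Icc (p j.castSucc) (p j.succ) ×ˢ Ioo (-ε) ε)

/-- `γ` is a critical point of the length on `Γ`: `d/ds L(γ^s) = 0` at `s = 0` for each variation
`(γ^s)` of `γ` in `Γ`. -/
def IsCriticalPoint (a b : ℝ) (y z : M) (γ : ℝ → M) : Prop :=
  ∀ (ε : ℝ) (Φ : ℝ → ℝ → M), P.IsVariation a b y z γ ε Φ →
    HasDerivAt (fun s ↦ P.length (Φ s) a b) 0 0

end PseudohermitianManifold

end Curves

end CR

end

noncomputable section

namespace CR

/-! ### Smoothness of functions and fields built from smooth tensors -/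

section SmoothFields

variable {E : Type*} [NormedAddCommGroup E] [NormedSpace ℝ E]
  {M : Type*} [TopologicalSpace M] [ChartedSpace E M] [IsManifold 𝓘(ℝ, E) ∞ M]

/-! Write `X = ∂_s γ^s`, `γ̇ = ∂_t γ^s`. Since `∇ g_θ = 0`, `½ ∂_s g(γ̇, γ̇) = g(∇_X γ̇, γ̇)`. Since
`∂_s` and `∂_t` commute, `∇_X γ̇ = ∇_γ̇ X + T_∇(X, γ̇)`. Using `∇ g_θ = 0` once more, `g(∇_γ̇ X, γ̇)
= ∂_t g(X, γ̇) - g(X, ∇_γ̇ γ̇)`. The resulting pointwise identity is `half_fderiv_energy`. It is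
checked in a chart, where the commutation is the symmetry of second derivatives and where coordinate
fields have zero bracket, so that torsion is the skew part of the connection coefficients. Symmetry
of `g_θ` is not part of its definition; it comes from the integrability of the CR structure
(`dθ_J_J`, `g_symm`).

If `γ^s` has constant speed `c(s)`, the left side of that identity at `s = 0` is the number `c(0)
c'(0)`, the same for all `t`. Integrating over `t` gives `(b - a) c(0) c'(0)` as boundary terms
minus the integral (`first_variation`), and `L(γ^s) = (b - a) c(s)` then yields (1).

For (2), purity makes `T_∇(u, v)` a multiple of `T` for horizontal `u`, `v`, and normality makes
`τ(v)` a multiple of `T` as well. So `T_∇(X, γ̇)` is orthogonal to a horizontal `γ̇`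
(`g_torsion_horizontal`), and along a lengthy geodesic the whole integrand vanishes. Applying
`first_variation` on each piece of the partition leaves boundary terms only. A geodesic has no
corners, so these telescope to the values at `a` and `b`, where `X = 0` because the end points are
fixed. Hence `c'(0) = 0`. -/

lemma SmoothVFAt.eventually {X : VF E M} {x : M} (hX : SmoothVFAt X x) :
    ∀ᶠ y in 𝓝 x, MDiffAt (T% X) y := by
  -- Smoothness of order `∞` at a point gives no single neighbourhood valid for all orders; order
  -- `1` does spread to a neighbourhood.
  have h1 := (contMDiffAt_iff_contMDiffAt_nhds (by simp)).1 (ContMDiffAt.of_le (m := 1) hX (by simp))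
  exact h1.mono fun y hy ↦ hy.mdifferentiableAt one_ne_zero

lemma SmoothVFAt.mdiffAt {X : VF E M} {x : M} (hX : SmoothVFAt X x) : MDiffAt (T% X) x :=
  hX.eventually.self_of_nhds

lemma SmoothOneForm.contMDiffAt_app {θ : OneForm E M} (hθ : SmoothOneForm θ)
    {X : VF E M} {x : M} (hX : SmoothVFAt X x) :
    ContMDiffAt 𝓘(ℝ, E) 𝓘(ℝ, ℝ) ∞ (θ.app X) x := by
  have h2 : ContMDiffAt 𝓘(ℝ, E) (𝓘(ℝ, E).prod 𝓘(ℝ, ℝ)) ∞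
      (fun y ↦ TotalSpace.mk' ℝ (E := Bundle.Trivial M ℝ) y (θ y (X y))) x :=
    ContMDiffAt.clm_bundle_apply (F₁ := E) (F₂ := ℝ) (hθ x) hX
  simp only [contMDiffAt_totalSpace] at h2
  exact h2.2

lemma SmoothEndField.smoothVFAt_app {J : EndField E M} (hJ : SmoothEndField J)
    {X : VF E M} {x : M} (hX : SmoothVFAt X x) : SmoothVFAt (J.app X) x :=
  ContMDiffAt.clm_bundle_apply (F₁ := E) (F₂ := E) (hJ x) hX

lemma SmoothVFAt.contMDiffAt_mvfderiv_apply {f : M → ℝ} {X : VF E M} {x : M}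
    (hf : ContMDiffAt 𝓘(ℝ, E) 𝓘(ℝ, ℝ) ∞ f x) (hX : SmoothVFAt X x) :
    ContMDiffAt 𝓘(ℝ, E) 𝓘(ℝ, ℝ) ∞ (fun y ↦ mvfderiv 𝓘(ℝ, E) f y (X y)) x := by
  have h1 := ContMDiffAt.mfderiv_const (m := ∞) hf (by simp)
  have h2 := ContMDiffAt.clm_apply_of_inCoordinates (E₁ := (TangentSpace 𝓘(ℝ, E) : M → Type _))
    (E₂ := (TangentSpace 𝓘(ℝ, ℝ) : ℝ → Type _)) (F₁ := E) (F₂ := ℝ) (b₁ := id) (b₂ := f)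
    (ϕ := fun y ↦ mfderiv 𝓘(ℝ, E) 𝓘(ℝ, ℝ) f y) (v := X) h1 hX hf
  exact (contMDiff_snd_tangentBundle_modelSpace ℝ 𝓘(ℝ, ℝ)).contMDiffAt.comp x h2

/-- The vector field with constant components `v` in the trivialization at `x₀`. -/
def constField (x₀ : M) (v : E) : VF E M :=
  fun x ↦ (trivializationAt E (TangentSpace 𝓘(ℝ, E) : M → Type _) x₀).symmL ℝ x v

lemma smoothVFAt_constField {x₀ x : M} (hx : x ∈ (chartAt E x₀).source) (v : E) :
    SmoothVFAt (constField x₀ v) x := by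
  have hx' : x ∈ (trivializationAt E (TangentSpace 𝓘(ℝ, E) : M → Type _) x₀).baseSet := by
    simpa using hx
  refine (Trivialization.contMDiffAt_section_iff _ hx').2 ?_
  refine (contMDiffAt_const (c := v)).congr_of_eventuallyEq ?_
  filter_upwards [(Trivialization.open_baseSet _).mem_nhds hx'] with y hy
  rw [constField, Trivialization.symmL_apply _ hy, Trivialization.apply_mk_symm _ hy]

variable [CompleteSpace E] [FiniteDimensional ℝ E]

/-- `extD` is defined pointwise by tensoriality, so its smooth dependence on the point has to be
read off the bracket formula, which holds near `x` for fields differentiable near `x`. -/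
lemma SmoothVFAt.contMDiffAt_extD {θ : OneForm E M} (hθ : SmoothOneForm θ)
    {X Y : VF E M} {x : M} (hX : SmoothVFAt X x) (hY : SmoothVFAt Y x) :
    ContMDiffAt 𝓘(ℝ, E) 𝓘(ℝ, ℝ) ∞ (fun y ↦ extD hθ y (X y) (Y y)) x := by
  have : IsManifold 𝓘(ℝ, E) (minSmoothness ℝ 2) M := by
    rw [minSmoothness_of_isRCLikeNormedField]; infer_instance
  have : IsManifold 𝓘(ℝ, E) (((⊤ : ℕ∞) : ℕ∞ω) + 1) M := ‹IsManifold 𝓘(ℝ, E) ∞ M›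
  have hb : SmoothVFAt (mlieBracket 𝓘(ℝ, E) X Y) x :=
    ContMDiffAt.mlieBracket_vectorField (m := ⊤) (n := ⊤) hX hY (by
      rw [minSmoothness_of_isRCLikeNormedField]; exact le_rfl)
  have h := ((hX.contMDiffAt_mvfderiv_apply (hθ.contMDiffAt_app hY)).sub
    (hY.contMDiffAt_mvfderiv_apply (hθ.contMDiffAt_app hX))).sub (hθ.contMDiffAt_app hb)
  refine (contMDiffAt_const (c := (1 / 2 : ℝ)).mul h).congr_of_eventuallyEq ?_
  filter_upwards [hX.eventually, hY.eventually] with y hy hy'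
  exact extD_apply hθ y hy hy'

namespace PseudohermitianManifold

lemma contMDiffAt_g (P : PseudohermitianManifold E M) {X Y : VF E M} {x : M}
    (hX : SmoothVFAt X x) (hY : SmoothVFAt Y x) :
    ContMDiffAt 𝓘(ℝ, E) 𝓘(ℝ, ℝ) ∞ (fun y ↦ P.g y (X y) (Y y)) x :=
  (hX.contMDiffAt_extD P.smooth_θ (P.smooth_J.smoothVFAt_app hY)).add
    ((P.smooth_θ.contMDiffAt_app hX).mul (P.smooth_θ.contMDiffAt_app hY))

end PseudohermitianManifold

end SmoothFields

lemma _root_.DifferentiableAt.hasFDerivAt_apply₂ {E F G H : Type*} [NormedAddCommGroup E]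
    [NormedSpace ℝ E] [NormedAddCommGroup F] [NormedSpace ℝ F] [NormedAddCommGroup G]
    [NormedSpace ℝ G] [NormedAddCommGroup H] [NormedSpace ℝ H] {B : E → F →L[ℝ] G →L[ℝ] H} {y : E}
    (hB : DifferentiableAt ℝ B y) (v : F) (w : G) :
    HasFDerivAt (fun z ↦ B z v w) (((fderiv ℝ B y).flip v).flip w) y := by
  have h := (hB.hasFDerivAt.clm_apply (hasFDerivAt_const v y)).clm_apply (hasFDerivAt_const w y)
  convert h using 1
  ext z
  simp

/-! ### Coordinate frames, the metric and the connection in a chart -/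

section Coordinates

variable {E : Type*} [NormedAddCommGroup E] [NormedSpace ℝ E]
  {M : Type*} [TopologicalSpace M] [ChartedSpace E M] [IsManifold 𝓘(ℝ, E) ∞ M]

/-- The components of tangent vectors at `x` in the trivialization at `x₀`. -/
def comps (x₀ x : M) : TangentSpace 𝓘(ℝ, E) x →L[ℝ] E :=
  (trivializationAt E (TangentSpace 𝓘(ℝ, E) : M → Type _) x₀).continuousLinearMapAt ℝ x

lemma mem_baseSet {x₀ x : M} (hx : x ∈ (chartAt E x₀).source) :
    x ∈ (trivializationAt E (TangentSpace 𝓘(ℝ, E) : M → Type _) x₀).baseSet := by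
  simpa using hx

lemma comps_constField {x₀ x : M} (hx : x ∈ (chartAt E x₀).source) (v : E) :
    comps x₀ x (constField x₀ v x) = v :=
  Trivialization.continuousLinearMapAt_symmL _ (mem_baseSet hx) v

lemma constField_comps {x₀ x : M} (hx : x ∈ (chartAt E x₀).source)
    (u : TangentSpace 𝓘(ℝ, E) x) : constField x₀ (comps x₀ x u) x = u :=
  Trivialization.symmL_continuousLinearMapAt _ (mem_baseSet hx) u

/-- This identifies the frame of the trivialization with the coordinate frame of the chart; the
vanishing of brackets and the chart formulas for velocities both depend on it. -/
lemma comps_eq_mfderiv {x₀ x : M} (hx : x ∈ (chartAt E x₀).source) :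
    comps x₀ x = mfderiv 𝓘(ℝ, E) 𝓘(ℝ, E) (extChartAt 𝓘(ℝ, E) x₀) x :=
  TangentBundle.continuousLinearMapAt_trivializationAt hx

lemma extend_eq_constField {x₀ x : M} (hx : x ∈ (chartAt E x₀).source)
    (u : TangentSpace 𝓘(ℝ, E) x₀) :
    (extend E u : VF E M) x = constField x₀ (comps x₀ x₀ u) x := by
  rw [constField, Trivialization.symmL_apply _ (mem_baseSet hx), comps,
    Trivialization.continuousLinearMapAt_apply_of_mem ℝ _ (mem_baseSet (mem_chart_source E x₀))]
  rfl

lemma extend_eventuallyEq_constField (x₀ : M) (u : TangentSpace 𝓘(ℝ, E) x₀) :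
    ∀ᶠ x in 𝓝 x₀, (extend E u : VF E M) x = constField x₀ (comps x₀ x₀ u) x := by
  filter_upwards [(chartAt E x₀).open_source.mem_nhds (mem_chart_source E x₀)] with x hx
  exact extend_eq_constField hx u

lemma smoothVFAt_extend {x₀ : M} (u : TangentSpace 𝓘(ℝ, E) x₀) :
    SmoothVFAt (extend E u) x₀ := by
  refine (smoothVFAt_constField (mem_chart_source E x₀) (comps x₀ x₀ u)).congr_of_eventuallyEq ?_
  filter_upwards [extend_eventuallyEq_constField x₀ u] with x hx
  rw [hx]

variable (E) in
/-- The constant vector field `v` on `E`. -/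
def constVF (v : E) : VF E E := fun _ ↦ v

lemma constField_eq_mpullback {x₀ x : M} (hx : x ∈ (chartAt E x₀).source) (v : E) :
    constField x₀ v x
      = mpullback 𝓘(ℝ, E) 𝓘(ℝ, E) (extChartAt 𝓘(ℝ, E) x₀) (constVF E v) x := by
  have hi := isInvertible_mfderiv_extChartAt (I := 𝓘(ℝ, E)) (x := x₀) (y := x) (by simpa using hx)
  refine ((hi.inverse_apply_eq).2 ?_).symm
  rw [← comps_eq_mfderiv hx]
  exact (comps_constField hx v).symm

lemma constField_add (x₀ x : M) (v w : E) :
    constField x₀ (v + w) x = constField x₀ v x + constField x₀ w x :=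
  map_add (Trivialization.symmL ℝ _ x) v w

lemma constField_smul (x₀ x : M) (c : ℝ) (v : E) :
    constField x₀ (c • v) x = c • constField x₀ v x :=
  map_smul (Trivialization.symmL ℝ _ x) c v

variable [CompleteSpace E]

/-- Near `x₀` these fields are pullbacks under the chart of constant fields on `E`. Pullback
commutes with brackets, and constant fields commute. -/
lemma mlieBracket_constField (x₀ : M) (v w : E) :
    mlieBracket 𝓘(ℝ, E) (constField x₀ v) (constField x₀ w) x₀ = 0 := by
  have : IsManifold 𝓘(ℝ, E) (minSmoothness ℝ 3) M := by
    rw [minSmoothness_of_isRCLikeNormedField]; infer_instance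
  have h : ∀ v : E, (constField x₀ v : VF E M) =ᶠ[𝓝 x₀]
      mpullback 𝓘(ℝ, E) 𝓘(ℝ, E) (extChartAt 𝓘(ℝ, E) x₀) (constVF E v) := fun v ↦ by
    filter_upwards [(chartAt E x₀).open_source.mem_nhds (mem_chart_source E x₀)] with x hx
    exact constField_eq_mpullback hx v
  have hc : ∀ (v : E) (y : E), MDifferentiableAt 𝓘(ℝ, E) (𝓘(ℝ, E).prod 𝓘(ℝ, E))
      (fun y ↦ TotalSpace.mk' E (E := (TangentSpace 𝓘(ℝ, E) : E → Type _)) y (constVF E v y)) y := fun v y ↦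
    (contMDiffAt_vectorSpace_iff_contDiffAt (n := 1) (V := constVF E v)).2
      contDiffAt_const |>.mdifferentiableAt one_ne_zero
  rw [(h v).mlieBracket_vectorField_eq (h w), ← mpullback_mlieBracket (n := 2) (hc v _) (hc w _)
    contMDiffAt_extChartAt (by rw [minSmoothness_of_isRCLikeNormedField])]
  have h0 : mlieBracket 𝓘(ℝ, E) (constVF E v) (constVF E w) (extChartAt 𝓘(ℝ, E) x₀ x₀) = 0 := by
    rw [← mlieBracketWithin_univ, mlieBracketWithin_eq_lieBracketWithin]
    change fderivWithin ℝ (fun _ : E ↦ w) univ _ v - fderivWithin ℝ (fun _ : E ↦ v) univ _ w = 0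
    simp
  rw [mpullback_apply, h0, map_zero]

lemma mlieBracket_extend (x₀ : M) (u v : TangentSpace 𝓘(ℝ, E) x₀) :
    mlieBracket 𝓘(ℝ, E) (extend E u) (extend E v) x₀ = 0 := by
  rw [Filter.EventuallyEq.mlieBracket_vectorField_eq (extend_eventuallyEq_constField x₀ u)
    (extend_eventuallyEq_constField x₀ v), mlieBracket_constField]

variable [FiniteDimensional ℝ E]

/-- In a coordinate frame the bracket term drops out, so torsion is the antisymmetrization of the
Christoffel symbols. -/
lemma torsion_eq_extend (D : CovariantDerivative 𝓘(ℝ, E) E (TangentSpace 𝓘(ℝ, E) : M → Type _))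
    (x : M) (u v : TangentSpace 𝓘(ℝ, E) x) :
    D.torsion x u v = D (extend E v) x u - D (extend E u) x v := by
  rw [D.torsion_apply_eq_extend, mlieBracket_extend]
  simp

namespace PseudohermitianManifold

variable (P : PseudohermitianManifold E M)

lemma g_add_left (x : M) (u u' v : TangentSpace 𝓘(ℝ, E) x) :
    P.g x (u + u') v = P.g x u v + P.g x u' v := by simp [g]; ring

lemma g_smul_left (x : M) (c : ℝ) (u v : TangentSpace 𝓘(ℝ, E) x) :
    P.g x (c • u) v = c * P.g x u v := by simp [g]; ring

lemma g_add_right (x : M) (u v v' : TangentSpace 𝓘(ℝ, E) x) :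
    P.g x u (v + v') = P.g x u v + P.g x u v' := by simp [g]; ring

lemma g_smul_right (x : M) (c : ℝ) (u v : TangentSpace 𝓘(ℝ, E) x) :
    P.g x u (c • v) = c * P.g x u v := by simp [g]; ring

/-- The Webster metric in the chart at `x₀`. -/
def gChart (x₀ : M) (y : E) : E →L[ℝ] E →L[ℝ] ℝ :=
  LinearMap.toContinuousBilinearMap
    (LinearMap.mk₂ ℝ (fun v w ↦ P.g ((extChartAt 𝓘(ℝ, E) x₀).symm y)
        (constField x₀ v ((extChartAt 𝓘(ℝ, E) x₀).symm y))
        (constField x₀ w ((extChartAt 𝓘(ℝ, E) x₀).symm y)))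
      (fun _ _ _ ↦ by rw [constField_add, g_add_left])
      (fun _ _ _ ↦ by rw [constField_smul, g_smul_left, smul_eq_mul])
      (fun _ _ _ ↦ by rw [constField_add, g_add_right])
      (fun _ _ _ ↦ by rw [constField_smul, g_smul_right, smul_eq_mul]))

lemma gChart_apply (x₀ : M) (y v w : E) :
    P.gChart x₀ y v w = P.g ((extChartAt 𝓘(ℝ, E) x₀).symm y)
        (constField x₀ v ((extChartAt 𝓘(ℝ, E) x₀).symm y))
        (constField x₀ w ((extChartAt 𝓘(ℝ, E) x₀).symm y)) := rfl

lemma g_constField {x₀ x : M} (hx : x ∈ (chartAt E x₀).source) (v w : E) :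
    P.g x (constField x₀ v x) (constField x₀ w x)
      = P.gChart x₀ (extChartAt 𝓘(ℝ, E) x₀ x) v w := by
  rw [gChart_apply, (extChartAt 𝓘(ℝ, E) x₀).left_inv (by simpa using hx)]

lemma g_eq_gChart {x₀ x : M} (hx : x ∈ (chartAt E x₀).source) (u v : TangentSpace 𝓘(ℝ, E) x) :
    P.g x u v = P.gChart x₀ (extChartAt 𝓘(ℝ, E) x₀ x) (comps x₀ x u) (comps x₀ x v) := by
  rw [← g_constField P hx, constField_comps hx, constField_comps hx]

/-- `E` is finite-dimensional, so smoothness of an operator-valued map can be tested on fixed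
vectors `v`, `w`, that is, on the metric coefficients. -/
lemma contDiffAt_gChart {x₀ x : M} (hx : x ∈ (chartAt E x₀).source) :
    ContDiffAt ℝ ∞ (P.gChart x₀) (extChartAt 𝓘(ℝ, E) x₀ x) := by
  have hx' : extChartAt 𝓘(ℝ, E) x₀ x ∈ (extChartAt 𝓘(ℝ, E) x₀).target :=
    (extChartAt 𝓘(ℝ, E) x₀).map_source (by simpa using hx)
  have ho : IsOpen (extChartAt 𝓘(ℝ, E) x₀).target := isOpen_extChartAt_target x₀
  suffices h : ContDiffOn ℝ ∞ (P.gChart x₀) (extChartAt 𝓘(ℝ, E) x₀).target from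
    h.contDiffAt (ho.mem_nhds hx')
  refine contDiffOn_clm_apply.2 fun v ↦ contDiffOn_clm_apply.2 fun w ↦ ?_
  rw [← contMDiffOn_iff_contDiffOn]
  intro y hy
  have hy' : (extChartAt 𝓘(ℝ, E) x₀).symm y ∈ (chartAt E x₀).source := by
    simpa using (extChartAt 𝓘(ℝ, E) x₀).map_target hy
  exact ContMDiffAt.comp_contMDiffWithinAt y (P.contMDiffAt_g (smoothVFAt_constField hy' v)
    (smoothVFAt_constField hy' w)) (contMDiffOn_extChartAt_symm x₀ y hy)

variable {P} in
-- This is `∂_w g_{uv} = g(Γ_w u, v) + g(u, Γ_w v)`, the equation `∇ g_θ = 0` at the centre of the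
-- chart, where `extend` has constant components.
lemma IsTanakaWebster.fderiv_gChart {D : LinearConnection E M} (hD : P.IsTanakaWebster D) (x₀ : M)
    (u v w : TangentSpace 𝓘(ℝ, E) x₀) :
    fderiv ℝ (P.gChart x₀) (extChartAt 𝓘(ℝ, E) x₀ x₀) (comps x₀ x₀ w) (comps x₀ x₀ u)
        (comps x₀ x₀ v)
      = P.g x₀ (D (extend E u) x₀ w) v + P.g x₀ u (D (extend E v) x₀ w) := by
  have h := hD.parallel_g x₀ (extend E u) (extend E v) w (smoothVFAt_extend u)
    (smoothVFAt_extend v)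
  rw [extend_apply_self, extend_apply_self] at h
  rw [← h]
  have hd := ((P.contDiffAt_gChart (mem_chart_source E x₀)).differentiableAt
    (by simp)).hasFDerivAt_apply₂ (comps x₀ x₀ u) (comps x₀ x₀ v)
  have he : (fun y ↦ P.g y (extend E u y) (extend E v y)) =ᶠ[𝓝 x₀]
      (fun y ↦ P.gChart x₀ y (comps x₀ x₀ u) (comps x₀ x₀ v)) ∘ extChartAt 𝓘(ℝ, E) x₀ := by
    filter_upwards [(chartAt E x₀).open_source.mem_nhds (mem_chart_source E x₀)] with x hx
    rw [extend_eq_constField hx, extend_eq_constField hx, g_constField P hx]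
    rfl
  have hc := (hd.hasMFDerivAt.comp x₀
    (mdifferentiableAt_extChartAt (mem_chart_source E x₀)).hasMFDerivAt).congr_of_eventuallyEq he
  rw [mvfderiv, hc.mfderiv, ← comps_eq_mfderiv (mem_chart_source E x₀)]
  rfl

end PseudohermitianManifold

end Coordinates

/-! ### Symmetry of the Webster metric and the torsion in the Sasakian case -/

section Algebra

variable {E : Type*} [NormedAddCommGroup E] [NormedSpace ℝ E]
  {M : Type*} [TopologicalSpace M] [ChartedSpace E M] [IsManifold 𝓘(ℝ, E) ∞ M]
  [FiniteDimensional ℝ E] [CompleteSpace E]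

lemma extD_antisymm {θ : OneForm E M} (hθ : SmoothOneForm θ) (x : M)
    (u v : TangentSpace 𝓘(ℝ, E) x) : extD hθ x u v = - extD hθ x v u := by
  have h1 := extD_apply hθ x (smoothVFAt_extend u).mdiffAt (smoothVFAt_extend v).mdiffAt
  have h2 := extD_apply hθ x (smoothVFAt_extend v).mdiffAt (smoothVFAt_extend u).mdiffAt
  have h3 := dAux_swap θ x (extend E u) (extend E v)
  simp only [dAux] at h3
  rw [← h1, ← h2] at h3
  simpa using h3

lemma extD_of_app_eventually_zero {θ : OneForm E M} (hθ : SmoothOneForm θ) {x : M} {X Y : VF E M}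
    (hX : SmoothVFAt X x) (hY : SmoothVFAt Y x) (hX0 : ∀ᶠ y in 𝓝 x, θ y (X y) = 0)
    (hY0 : ∀ᶠ y in 𝓝 x, θ y (Y y) = 0) :
    extD hθ x (X x) (Y x) = - (1 / 2) * θ x (mlieBracket 𝓘(ℝ, E) X Y x) := by
  have h0 : ∀ {f : M → ℝ}, (∀ᶠ y in 𝓝 x, f y = 0) → mvfderiv 𝓘(ℝ, E) f x = 0 := fun {f} hf ↦ by
    have : f =ᶠ[𝓝 x] fun _ ↦ 0 := hf
    rw [mvfderiv, this.mfderiv_eq, mfderiv_const]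
    rfl
  rw [extD_apply hθ x hX.mdiffAt hY.mdiffAt, h0 (f := θ.app Y) hY0, h0 (f := θ.app X) hX0]
  simp

namespace PseudohermitianManifold

variable (P : PseudohermitianManifold E M)

/-- An extension of `u` to a vector field which is horizontal near `x` if `u` is. -/
def horizontalExtend {x : M} (u : TangentSpace 𝓘(ℝ, E) x) : VF E M :=
  extend E u - (P.θ.app (extend E u)) • P.T

lemma θ_horizontalExtend {x : M} (u : TangentSpace 𝓘(ℝ, E) x) (y : M) :
    P.θ y (P.horizontalExtend u y) = 0 := by
  simp [horizontalExtend, OneForm.app, P.θ_T]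

lemma horizontalExtend_self {x : M} {u : TangentSpace 𝓘(ℝ, E) x} (hu : P.θ x u = 0) :
    P.horizontalExtend u x = u := by
  simp [horizontalExtend, OneForm.app, hu]

lemma smoothVFAt_horizontalExtend {x : M} (u : TangentSpace 𝓘(ℝ, E) x) :
    SmoothVFAt (P.horizontalExtend u) x :=
  ContMDiffAt.sub_section (smoothVFAt_extend u)
    (ContMDiffAt.smul_section (P.smooth_θ.contMDiffAt_app (smoothVFAt_extend u)) (P.smooth_T x))

/-- The Levi form is `J`-invariant, by the formal integrability of the CR structure. -/
lemma dθ_J_J {x : M} {u v : TangentSpace 𝓘(ℝ, E) x} (hu : P.θ x u = 0) (hv : P.θ x v = 0) :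
    P.dθ x (P.J x u) (P.J x v) = P.dθ x u v := by
  set X := P.horizontalExtend u with hXdef
  set Y := P.horizontalExtend v with hYdef
  have hX : SmoothVFAt X x := P.smoothVFAt_horizontalExtend u
  have hY : SmoothVFAt Y x := P.smoothVFAt_horizontalExtend v
  have hJX := P.smooth_J.smoothVFAt_app hX
  have hJY := P.smooth_J.smoothVFAt_app hY
  have hX0 : ∀ y, P.θ y (X y) = 0 := P.θ_horizontalExtend u
  have hY0 : ∀ y, P.θ y (Y y) = 0 := P.θ_horizontalExtend v
  have hXx : X x = u := P.horizontalExtend_self hu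
  have hYx : Y x = v := P.horizontalExtend_self hv
  have h1 := extD_of_app_eventually_zero P.smooth_θ hX hY (.of_forall hX0) (.of_forall hY0)
  have h2 := extD_of_app_eventually_zero P.smooth_θ hJX hJY
    (.of_forall fun y ↦ P.θ_J y _ (hX0 y)) (.of_forall fun y ↦ P.θ_J y _ (hY0 y))
  have hneg : ∀ {Z : VF E M}, SmoothVFAt Z x → SmoothVFAt ((-1 : ℝ) • Z) x := fun hZ ↦
    ContMDiffAt.smul_section (contMDiffAt_const (c := (-1 : ℝ))) hZ
  -- The real part of `[X - i JX, Y - i JY]` is `[X, Y] - [JX, JY]`. Integrability makes it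
  -- horizontal, so `θ` takes the same value on both brackets.
  have h3 := (P.integrable x (X, (-1 : ℝ) • P.J.app X) (Y, (-1 : ℝ) • P.J.app Y) hX (hneg hJX) hY
    (hneg hJY) (.of_forall fun y ↦ ⟨hX0 y, by simp [EndField.app]⟩)
    (.of_forall fun y ↦ ⟨hY0 y, by simp [EndField.app]⟩)).1
  simp only [extC] at h3
  rw [mlieBracket_const_smul_left hJX.mdiffAt, mlieBracket_const_smul_right hJY.mdiffAt,
    smul_smul, map_sub] at h3
  simp only [EndField.app, hXx, hYx] at h1 h2
  rw [dθ, h1, h2]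
  simp only [mul_neg, mul_one, neg_neg, one_smul] at h3
  rw [sub_eq_zero.1 h3]

lemma θ_sub_smul_T (x : M) (u : TangentSpace 𝓘(ℝ, E) x) :
    P.θ x (u - P.θ x u • P.T x) = 0 := by simp [P.θ_T]

lemma J_sub_smul_T (x : M) (u : TangentSpace 𝓘(ℝ, E) x) (c : ℝ) :
    P.J x (u - c • P.T x) = P.J x u := by simp [P.J_T]

/-- For horizontal vectors, `dθ(u, Jv) = dθ(Ju, J²v) = -dθ(Ju, v) = dθ(v, Ju)`. The `T`-components
contribute only the symmetric term `θ(u) θ(v)`, because `JT = 0` and `T ⌟ dθ = 0`. -/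
lemma g_symm (x : M) (u v : TangentSpace 𝓘(ℝ, E) x) : P.g x u v = P.g x v u := by
  have hT : ∀ (w w' : TangentSpace 𝓘(ℝ, E) x) (c : ℝ),
      P.dθ x (w - c • P.T x) w' = P.dθ x w w' := fun w w' c ↦ by
    simp [dθ, P.T_contract_dθ]
  suffices h : ∀ u v : TangentSpace 𝓘(ℝ, E) x, P.θ x u = 0 → P.θ x v = 0 →
      P.dθ x u (P.J x v) = P.dθ x v (P.J x u) by
    have := h _ _ (P.θ_sub_smul_T x u) (P.θ_sub_smul_T x v)
    rw [hT, hT, J_sub_smul_T, J_sub_smul_T] at this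
    rw [g, g, this, mul_comm (P.θ x u)]
  intro u v hu hv
  rw [← P.dθ_J_J hu (P.θ_J x v hv), P.J_J x v hv, map_neg, dθ, extD_antisymm, neg_neg]

variable {P} {D : LinearConnection E M}

/-- The real part of the `(1,0)`–`(1,0)` condition is `T_∇(u, v) - T_∇(Ju, Jv) = 0`; that of the
mixed condition says that `T_∇(u, v) + T_∇(Ju, Jv)` is a multiple of `T`. Their sum gives the claim.
-/
lemma IsTanakaWebster.torsion_horizontal (hD : P.IsTanakaWebster D) {x : M}
    {u v : TangentSpace 𝓘(ℝ, E) x} (hu : P.θ x u = 0) (hv : P.θ x v = 0) :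
    ∃ c : ℝ, D.torsion x u v = c • P.T x := by
  have hZ : (u, - P.J x u) ∈ T10 P.θ P.J x := ⟨hu, rfl⟩
  have hW : (v, - P.J x v) ∈ T10 P.θ P.J x := ⟨hv, rfl⟩
  have h1 := congrArg Prod.fst (hD.pure_holomorphic x _ hZ _ hW)
  have h2 := congrArg Prod.fst (hD.pure_mixed x _ hZ _ hW)
  simp only [extC, conjC, smulC, map_neg, _root_.neg_apply, neg_neg,
    Prod.fst_zero] at h1 h2
  generalize (2 * Complex.I * P.levi x (u, -P.J x u) (v, -P.J x v)).re = c at h2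
  refine ⟨c / 2, ?_⟩
  have h3 : (2 : ℝ) • D.torsion x u v = c • P.T x := by
    rw [← h2, sub_neg_eq_add, sub_eq_zero.1 h1, two_smul]
  rw [div_eq_inv_mul, mul_smul, ← h3, smul_smul]
  norm_num

/-- Normality applied to `T` and `Y` reduces to `J²[T, Y] = J[T, JY]`. Expanding the torsion,
`J²τ(u) = J²∇_T Y - J²[T, Y]` and `Jτ(Ju) = J²∇_T Y - J[T, JY]`, so the two agree. They are also
opposite, since `τ` anticommutes with `J`. The conclusion says that `τ(u)` is a multiple of `T`,
which is all that is needed. -/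
lemma IsTanakaWebster.J_J_tau (hD : P.IsTanakaWebster D) (hS : P.IsSasakian) (x : M)
    (u : TangentSpace 𝓘(ℝ, E) x) : P.J x (P.J x (P.tau D x u)) = 0 := by
  have hT := P.smooth_T x
  have hY := smoothVFAt_extend u
  have hJY := P.smooth_J.smoothVFAt_app hY
  have hJT : P.J.app P.T = 0 := by ext y; exact P.J_T y
  -- `J ∇_w T = ∇_w (JT) = 0`, so the terms differentiating `T` disappear after applying `J`.
  have hDT : ∀ w, P.J x (D P.T x w) = 0 := fun w ↦ by
    rw [← hD.parallel_J x P.T w hT, hJT, CovariantDerivative.zero]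
    rfl
  have h1 := hS x P.T (extend E u) hT hY
  rw [hJT, mlieBracket_zero_left, mlieBracket_zero_left, dθ, P.T_contract_dθ] at h1
  have h2 := D.torsion_apply hT.mdiffAt hY.mdiffAt
  have h3 := D.torsion_apply hT.mdiffAt hJY.mdiffAt
  rw [hD.parallel_J x _ _ hY] at h3
  have h4 := congrArg (P.J x) (hD.tau_J x u)
  simp only [tau, EndField.app, extend_apply_self] at h2 h3 h4 ⊢
  have h5 := congrArg (fun w ↦ P.J x (P.J x w)) h2
  have h6 := congrArg (P.J x) h3
  simp only [map_sub, map_add, hDT, map_zero, Pi.zero_apply, sub_zero, add_zero, neg_zero, mul_zero,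
    zero_smul] at h1 h4 h5 h6
  have h7 : (2 : ℝ) • P.J x (P.J x (D.torsion x (P.T x) u)) = 0 := by
    rw [two_smul]
    nth_rw 1 [h5]
    rw [eq_neg_of_add_eq_zero_right h4, h6, sub_eq_zero.1 h1]
    abel
  simpa using h7

lemma g_eq_zero_of_J_J {x : M} {u v : TangentSpace 𝓘(ℝ, E) x} (hu : P.J x (P.J x u) = 0)
    (hv : P.θ x v = 0) : P.g x u v = 0 := by
  have h := P.J_J x _ (P.θ_sub_smul_T x u)
  rw [J_sub_smul_T, hu, eq_comm, neg_eq_zero, sub_eq_zero] at h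
  rw [h, g_smul_left, P.g_T_left x v hv, mul_zero]

/-- Split `u = (u - θ(u) T) + θ(u) T`. Both parts contribute a multiple of `T` to the torsion with
`v`, and `T` is orthogonal to the horizontal `v`. -/
lemma IsTanakaWebster.g_torsion_horizontal (hD : P.IsTanakaWebster D) (hS : P.IsSasakian) {x : M}
    (u : TangentSpace 𝓘(ℝ, E) x) {v : TangentSpace 𝓘(ℝ, E) x} (hv : P.θ x v = 0) :
    P.g x (D.torsion x u v) v = 0 := by
  obtain ⟨c, hc⟩ := hD.torsion_horizontal (P.θ_sub_smul_T x u) hv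
  have h : D.torsion x u v = c • P.T x + P.θ x u • P.tau D x v := by
    rw [← hc, tau]
    simp
  rw [h, g_add_left, g_smul_left, g_smul_left, P.g_T_left x v hv,
    g_eq_zero_of_J_J (hD.J_J_tau hS x v) hv]
  simp

end PseudohermitianManifold

end Algebra

/-! ### Product rule and iterated derivatives -/

section Calculus

variable {V E F G H : Type*} [NormedAddCommGroup V] [NormedSpace ℝ V] [NormedAddCommGroup E]
  [NormedSpace ℝ E] [NormedAddCommGroup F] [NormedSpace ℝ F] [NormedAddCommGroup G]
  [NormedSpace ℝ G] [NormedAddCommGroup H] [NormedSpace ℝ H]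
  {B : E → F →L[ℝ] G →L[ℝ] H} {u : V → E} {p : V → F} {r : V → G} {q : V}

lemma fderiv_bilinear_comp (hB : DifferentiableAt ℝ B (u q)) (hu : DifferentiableAt ℝ u q)
    (hp : DifferentiableAt ℝ p q) (hr : DifferentiableAt ℝ r q) (h : V) :
    fderiv ℝ (fun z ↦ B (u z) (p z) (r z)) q h
      = fderiv ℝ B (u q) (fderiv ℝ u q h) (p q) (r q) + B (u q) (fderiv ℝ p q h) (r q)
        + B (u q) (p q) (fderiv ℝ r q h) := by
  have h0 : HasFDerivAt (fun z ↦ B (u z)) (fderiv ℝ B (u q) ∘L fderiv ℝ u q) q :=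
    HasFDerivAt.comp (g := B) q hB.hasFDerivAt hu.hasFDerivAt
  have h1 := (h0.clm_apply hp.hasFDerivAt).clm_apply
    hr.hasFDerivAt
  rw [HasFDerivAt.fderiv h1]
  simp
  abel

lemma fderiv_fderiv_apply {f : V → E} {q : V} (hf : DifferentiableAt ℝ (fderiv ℝ f) q) (v w : V) :
    fderiv ℝ (fun z ↦ fderiv ℝ f z v) q w = fderiv ℝ (fderiv ℝ f) q w v := by
  rw [(hf.hasFDerivAt.clm_apply (hasFDerivAt_const v q)).fderiv]
  simp

end Calculus

/-! ### Two-parameter maps and the pointwise variation identity -/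

section Maps

variable {E : Type*} [NormedAddCommGroup E] [NormedSpace ℝ E]
  {M : Type*} [TopologicalSpace M] [ChartedSpace E M] [IsManifold 𝓘(ℝ, E) ∞ M]

lemma comps_velocity {γ : ℝ → M} {S : Set ℝ} {t : ℝ} {x₀ : M}
    (hγ : MDifferentiableWithinAt 𝓘(ℝ, ℝ) 𝓘(ℝ, E) γ S t) (hS : UniqueDiffWithinAt ℝ S t)
    (hx : γ t ∈ (chartAt E x₀).source) :
    comps x₀ (γ t) (velocity γ S t) = derivWithin (extChartAt 𝓘(ℝ, E) x₀ ∘ γ) S t := by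
  have h := mfderiv_comp_mfderivWithin t (mdifferentiableAt_extChartAt (I := 𝓘(ℝ, E)) hx) hγ
    hS.uniqueMDiffWithinAt
  rw [mfderivWithin_eq_fderivWithin] at h
  rw [velocity, comps_eq_mfderiv hx]
  exact (congrArg (fun L ↦ L (1 : ℝ)) h).symm

lemma differentiableWithinAt_chart_comp {V : Type*} [NormedAddCommGroup V] [NormedSpace ℝ V]
    {f : V → M} {R : Set V} {q : V} {x₀ : M}
    (hf : MDifferentiableWithinAt 𝓘(ℝ, V) 𝓘(ℝ, E) f R q) (hx : f q ∈ (chartAt E x₀).source) :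
    DifferentiableWithinAt ℝ (extChartAt 𝓘(ℝ, E) x₀ ∘ f) R q :=
  ((mdifferentiableAt_extChartAt (I := 𝓘(ℝ, E)) hx).comp_mdifferentiableWithinAt q
    hf).differentiableWithinAt

lemma contDiffWithinAt_chart_comp {V : Type*} [NormedAddCommGroup V] [NormedSpace ℝ V]
    {f : V → M} {R : Set V} {q : V} {x₀ : M}
    (hf : ContMDiffWithinAt 𝓘(ℝ, V) 𝓘(ℝ, E) ∞ f R q) (hx : f q ∈ (chartAt E x₀).source) :
    ContDiffWithinAt ℝ ∞ (extChartAt 𝓘(ℝ, E) x₀ ∘ f) R q :=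
  ((contMDiffAt_extChartAt' (I := 𝓘(ℝ, E)) hx).comp_contMDiffWithinAt q hf).contDiffWithinAt

/-- Used for the lines `t ↦ (t, s)` and `s ↦ (t, s)` in the rectangle `R`. Derivatives within `R`
keep the formula valid on its edges, so energy and pairing are smooth up to `t = a` and `t = b`. -/
lemma comps_velocity_comp {V : Type*} [NormedAddCommGroup V] [NormedSpace ℝ V]
    {f : V → M} {R : Set V} {c : ℝ → V} {c' : V} {S : Set ℝ} {t : ℝ} {x₀ : M}
    (hf : MDifferentiableWithinAt 𝓘(ℝ, V) 𝓘(ℝ, E) f R (c t))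
    (hc : HasDerivWithinAt c c' S t) (hm : MapsTo c S R) (hS : UniqueDiffWithinAt ℝ S t)
    (hx : f (c t) ∈ (chartAt E x₀).source) :
    comps x₀ (f (c t)) (velocity (f ∘ c) S t)
      = fderivWithin ℝ (extChartAt 𝓘(ℝ, E) x₀ ∘ f) R (c t) c' := by
  have h1 : MDifferentiableWithinAt 𝓘(ℝ, ℝ) 𝓘(ℝ, E) (f ∘ c) S t :=
    hf.comp t hc.differentiableWithinAt.mdifferentiableWithinAt hm
  refine (comps_velocity h1 hS hx).trans ?_
  exact ((differentiableWithinAt_chart_comp hf hx).hasFDerivWithinAt.comp_hasDerivWithinAt t hc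
    hm).derivWithin hS

variable {f : ℝ × ℝ → M} {S I : Set ℝ} {q : ℝ × ℝ}

/-- The velocity of `t ↦ f (t, s)`. -/
def vel₁ (f : ℝ × ℝ → M) (S : Set ℝ) (q : ℝ × ℝ) : TangentSpace 𝓘(ℝ, E) (f q) :=
  velocity (fun t ↦ f (t, q.2)) S q.1

/-- The velocity of `s ↦ f (t, s)`. -/
def vel₂ (f : ℝ × ℝ → M) (I : Set ℝ) (q : ℝ × ℝ) : TangentSpace 𝓘(ℝ, E) (f q) :=
  velocity (fun s ↦ f (q.1, s)) I q.2

lemma comps_vel₁ {x₀ : M} (hf : MDifferentiableWithinAt 𝓘(ℝ, ℝ × ℝ) 𝓘(ℝ, E) f (S ×ˢ I) q)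
    (hS : UniqueDiffWithinAt ℝ S q.1) (hq : q.2 ∈ I) (hx : f q ∈ (chartAt E x₀).source) :
    comps x₀ (f q) (vel₁ f S q)
      = fderivWithin ℝ (extChartAt 𝓘(ℝ, E) x₀ ∘ f) (S ×ˢ I) q (1, 0) :=
  comps_velocity_comp (c := fun t ↦ (t, q.2)) hf
    ((hasDerivWithinAt_id _ _).prodMk (hasDerivWithinAt_const _ _ _)) (fun _ ht ↦ ⟨ht, hq⟩) hS hx

lemma comps_vel₂ {x₀ : M} (hf : MDifferentiableWithinAt 𝓘(ℝ, ℝ × ℝ) 𝓘(ℝ, E) f (S ×ˢ I) q)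
    (hI : UniqueDiffWithinAt ℝ I q.2) (hq : q.1 ∈ S) (hx : f q ∈ (chartAt E x₀).source) :
    comps x₀ (f q) (vel₂ f I q)
      = fderivWithin ℝ (extChartAt 𝓘(ℝ, E) x₀ ∘ f) (S ×ˢ I) q (0, 1) :=
  comps_velocity_comp (c := fun s ↦ (q.1, s)) hf
    ((hasDerivWithinAt_const _ _ _).prodMk (hasDerivWithinAt_id _ _)) (fun _ ht ↦ ⟨hq, ht⟩) hI hx

variable [FiniteDimensional ℝ E] [CompleteSpace E]

namespace PseudohermitianManifold

variable (P : PseudohermitianManifold E M)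

/-- The squared length of the velocity of `t ↦ f (t, s)`. -/
def energy (f : ℝ × ℝ → M) (S : Set ℝ) (q : ℝ × ℝ) : ℝ :=
  P.g (f q) (vel₁ f S q) (vel₁ f S q)

/-- The product of the two velocities of `f`. -/
def pairing (f : ℝ × ℝ → M) (S I : Set ℝ) (q : ℝ × ℝ) : ℝ :=
  P.g (f q) (vel₂ f I q) (vel₁ f S q)

/-- The chart is frozen at `f q` while `z` varies, which turns a function on varying tangent spaces
into one that ordinary calculus can differentiate at `q`. -/
lemma energy_eventuallyEq (hf : ContMDiffOn 𝓘(ℝ, ℝ × ℝ) 𝓘(ℝ, E) ∞ f (S ×ˢ I))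
    (hS : UniqueDiffOn ℝ S) (hq : q ∈ S ×ˢ I) :
    P.energy f S =ᶠ[𝓝[S ×ˢ I] q] fun z ↦ P.gChart (f q) ((extChartAt 𝓘(ℝ, E) (f q) ∘ f) z)
      (fderivWithin ℝ (extChartAt 𝓘(ℝ, E) (f q) ∘ f) (S ×ˢ I) z (1, 0))
      (fderivWithin ℝ (extChartAt 𝓘(ℝ, E) (f q) ∘ f) (S ×ˢ I) z (1, 0)) := by
  filter_upwards [self_mem_nhdsWithin, (hf q hq).continuousWithinAt.preimage_mem_nhdsWithin
    ((chartAt E (f q)).open_source.mem_nhds (mem_chart_source E (f q)))] with z hz hzx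
  have hd := (hf z hz).mdifferentiableWithinAt (by simp)
  rw [energy, g_eq_gChart P hzx, comps_vel₁ hd (hS _ hz.1) hz.2 hzx]
  rfl

lemma pairing_eventuallyEq (hf : ContMDiffOn 𝓘(ℝ, ℝ × ℝ) 𝓘(ℝ, E) ∞ f (S ×ˢ I))
    (hS : UniqueDiffOn ℝ S) (hI : UniqueDiffOn ℝ I) (hq : q ∈ S ×ˢ I) :
    P.pairing f S I =ᶠ[𝓝[S ×ˢ I] q] fun z ↦ P.gChart (f q) ((extChartAt 𝓘(ℝ, E) (f q) ∘ f) z)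
      (fderivWithin ℝ (extChartAt 𝓘(ℝ, E) (f q) ∘ f) (S ×ˢ I) z (0, 1))
      (fderivWithin ℝ (extChartAt 𝓘(ℝ, E) (f q) ∘ f) (S ×ˢ I) z (1, 0)) := by
  filter_upwards [self_mem_nhdsWithin, (hf q hq).continuousWithinAt.preimage_mem_nhdsWithin
    ((chartAt E (f q)).open_source.mem_nhds (mem_chart_source E (f q)))] with z hz hzx
  have hd := (hf z hz).mdifferentiableWithinAt (by simp)
  rw [pairing, g_eq_gChart P hzx, comps_vel₁ hd (hS _ hz.1) hz.2 hzx,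
    comps_vel₂ hd (hI _ hz.2) hz.1 hzx]
  rfl

lemma contDiffWithinAt_gChart_comp (hf : ContMDiffOn 𝓘(ℝ, ℝ × ℝ) 𝓘(ℝ, E) ∞ f (S ×ˢ I))
    (hS : UniqueDiffOn ℝ S) (hI : UniqueDiffOn ℝ I) (hq : q ∈ S ×ˢ I) (v w : ℝ × ℝ) :
    ContDiffWithinAt ℝ ∞ (fun z ↦ P.gChart (f q) ((extChartAt 𝓘(ℝ, E) (f q) ∘ f) z)
      (fderivWithin ℝ (extChartAt 𝓘(ℝ, E) (f q) ∘ f) (S ×ˢ I) z v)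
      (fderivWithin ℝ (extChartAt 𝓘(ℝ, E) (f q) ∘ f) (S ×ˢ I) z w)) (S ×ˢ I) q := by
  have hu := contDiffWithinAt_chart_comp (hf q hq) (mem_chart_source E (f q))
  have hu' := hu.fderivWithin_right (m := ∞) (hS.prod hI) (by simp) hq
  have hB := (P.contDiffAt_gChart (mem_chart_source E (f q))).comp_contDiffWithinAt q hu
  exact (hB.clm_apply (hu'.clm_apply contDiffWithinAt_const)).clm_apply
    (hu'.clm_apply contDiffWithinAt_const)

lemma contDiffOn_energy (hf : ContMDiffOn 𝓘(ℝ, ℝ × ℝ) 𝓘(ℝ, E) ∞ f (S ×ˢ I))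
    (hS : UniqueDiffOn ℝ S) (hI : UniqueDiffOn ℝ I) : ContDiffOn ℝ ∞ (P.energy f S) (S ×ˢ I) := fun _ hq ↦
  (contDiffWithinAt_gChart_comp P hf hS hI hq _ _).congr_of_eventuallyEq_of_mem
    (energy_eventuallyEq P hf hS hq) hq

lemma contDiffOn_pairing (hf : ContMDiffOn 𝓘(ℝ, ℝ × ℝ) 𝓘(ℝ, E) ∞ f (S ×ˢ I))
    (hS : UniqueDiffOn ℝ S) (hI : UniqueDiffOn ℝ I) : ContDiffOn ℝ ∞ (P.pairing f S I) (S ×ˢ I) := fun _ hq ↦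
  (contDiffWithinAt_gChart_comp P hf hS hI hq _ _).congr_of_eventuallyEq_of_mem
    (pairing_eventuallyEq P hf hS hI hq) hq

lemma g_sub_left (x : M) (u u' v : TangentSpace 𝓘(ℝ, E) x) :
    P.g x (u - u') v = P.g x u v - P.g x u' v := by
  rw [eq_sub_iff_add_eq, ← g_add_left, sub_add_cancel]

lemma gChart_symm (x₀ : M) (y v w : E) : P.gChart x₀ y v w = P.gChart x₀ y w v := by
  rw [gChart_apply, g_symm, gChart_apply]

variable {P} in
-- Invariantly: `½ ∂_s g(γ̇, γ̇) = g(∇_X γ̇, γ̇)`, `∇_X γ̇ = ∇_γ̇ X + T_∇(X, γ̇)` and `g(∇_γ̇ X, γ̇)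
-- = ∂_t g(X, γ̇) - g(X, ∇_γ̇ γ̇)`. In the chart at `f q`, both derivatives are expanded by the
-- product rule, the derivative of the metric is replaced through `fderiv_gChart`, and the rest is
-- linear. Only interior points are treated, so all derivatives are two-sided.
lemma IsTanakaWebster.half_fderiv_energy {D : LinearConnection E M} (hD : P.IsTanakaWebster D)
    (hf : ContMDiffOn 𝓘(ℝ, ℝ × ℝ) 𝓘(ℝ, E) ∞ f (S ×ˢ I))
    (hS : UniqueDiffOn ℝ S) (hI : UniqueDiffOn ℝ I) (hqS : S ∈ 𝓝 q.1) (hqI : I ∈ 𝓝 q.2) :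
    (1 / 2) * fderiv ℝ (P.energy f S) q (0, 1)
      = fderiv ℝ (P.pairing f S I) q (1, 0)
        - (P.g (f q) (vel₂ f I q) (accel D (fun t ↦ f (t, q.2)) S q.1)
          - P.g (f q) (D.torsion (f q) (vel₂ f I q) (vel₁ f S q)) (vel₁ f S q)) := by
  have hR : S ×ˢ I ∈ 𝓝 q := prod_mem_nhds hqS hqI
  have hq : q ∈ S ×ˢ I := mem_of_mem_nhds hR
  have hx := mem_chart_source E (f q)
  set u := extChartAt 𝓘(ℝ, E) (f q) ∘ f with hu_def
  have hu : ContDiffAt ℝ ∞ u q := (contDiffWithinAt_chart_comp (hf q hq) hx).contDiffAt hR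
  have hw : ∀ᶠ z in 𝓝 q, fderivWithin ℝ u (S ×ˢ I) z = fderiv ℝ u z := by
    filter_upwards [eventually_mem_nhds_iff.2 hR] with z hz
    exact fderivWithin_of_mem_nhds hz
  have hd2 : DifferentiableAt ℝ (fderiv ℝ u) q :=
    (hu.fderiv_right (m := ∞) (by simp)).differentiableAt (by simp)
  have hd1 : ∀ v, DifferentiableAt ℝ (fun z ↦ fderiv ℝ u z v) q := fun v ↦
    hd2.clm_apply (differentiableAt_const v)
  have hB := (P.contDiffAt_gChart hx).differentiableAt (by simp)
  have hdu := hu.differentiableAt (by simp)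
  have hmd := (hf q hq).mdifferentiableWithinAt (n := ∞) (by simp)
  have hF := (P.energy_eventuallyEq hf hS hq).filter_mono (nhdsWithin_eq_nhds.2 hR).ge
  have hG := (P.pairing_eventuallyEq hf hS hI hq).filter_mono (nhdsWithin_eq_nhds.2 hR).ge
  rw [← hu_def] at hF hG
  have hF' : P.energy f S =ᶠ[𝓝 q] fun z ↦ P.gChart (f q) (u z) (fderiv ℝ u z (1, 0))
      (fderiv ℝ u z (1, 0)) := by
    filter_upwards [hF, hw] with z h1 h2
    rw [h1, h2]
  have hG' : P.pairing f S I =ᶠ[𝓝 q] fun z ↦ P.gChart (f q) (u z) (fderiv ℝ u z (0, 1))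
      (fderiv ℝ u z (1, 0)) := by
    filter_upwards [hG, hw] with z h1 h2
    rw [h1, h2]
  have ha : comps (f q) (f q) (vel₁ f S q) = fderiv ℝ u q (1, 0) := by
    rw [comps_vel₁ hmd (hS _ hq.1) hq.2 hx, ← hu_def, hw.self_of_nhds]
  have hb : comps (f q) (f q) (vel₂ f I q) = fderiv ℝ u q (0, 1) := by
    rw [comps_vel₂ hmd (hI _ hq.2) hq.1 hx, ← hu_def, hw.self_of_nhds]
  have hacc : P.g (f q) (vel₂ f I q) (accel D (fun t ↦ f (t, q.2)) S q.1)
      = P.gChart (f q) (u q) (fderiv ℝ u q (0, 1)) (fderiv ℝ (fderiv ℝ u) q (1, 0) (1, 0))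
        + P.g (f q) (vel₂ f I q) (D (extend E (vel₁ f S q)) (f q) (vel₁ f S q)) := by
    have h1 : accel D (fun t ↦ f (t, q.2)) S q.1
        = constField (f q) (derivWithin (fun t ↦ comps (f q) (f (t, q.2)) (vel₁ f S (t, q.2))) S
          q.1) (f q) + D (extend E (vel₁ f S q)) (f q) (vel₁ f S q) := rfl
    have h2 : (fun t ↦ comps (f q) (f (t, q.2)) (vel₁ f S (t, q.2)))
        =ᶠ[𝓝 q.1] fun t ↦ fderiv ℝ u (t, q.2) (1, 0) := by
      have hc : Tendsto (fun t ↦ (t, q.2)) (𝓝 q.1) (𝓝 q) :=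
        (Continuous.prodMk_left q.2).tendsto' _ _ rfl
      filter_upwards [hc.eventually hw, hc.eventually hR, hc.eventually
        (((hf q hq).continuousWithinAt.continuousAt hR).preimage_mem_nhds
          ((chartAt E (f q)).open_source.mem_nhds hx))] with t h1 h2 h3
      rw [comps_vel₁ ((hf _ h2).mdifferentiableWithinAt (by simp)) (hS _ h2.1) h2.2 h3, ← hu_def,
        h1]
    have h3 : HasDerivAt (fun t ↦ fderiv ℝ u (t, q.2) (1, 0))
        (fderiv ℝ (fderiv ℝ u) q (1, 0) (1, 0)) q.1 := by
      rw [← fderiv_fderiv_apply hd2]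
      exact (hd1 (1, 0)).hasFDerivAt.comp_hasDerivAt q.1
        ((hasDerivAt_id q.1).prodMk (hasDerivAt_const q.1 q.2))
    rw [h1, derivWithin_of_mem_nhds hqS, h2.deriv_eq, h3.deriv, g_add_right,
      g_eq_gChart P hx _ (constField _ _ _), comps_constField hx, hb]
    rfl
  -- This is where `∂_s` and `∂_t` commute: the second-order parts of `∇_X γ̇` and `∇_γ̇ X`
  -- coincide, leaving only the torsion.
  have hsymm : fderiv ℝ (fderiv ℝ u) q (1, 0) (0, 1) = fderiv ℝ (fderiv ℝ u) q (0, 1) (1, 0) :=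
    (hu.of_le (m := 2) ENat.LEInfty.out).isSymmSndFDerivAt
      (by rw [minSmoothness_of_isRCLikeNormedField]) _ _
  have hF1 := fderiv_bilinear_comp (u := u) hB hdu (hd1 (1, 0)) (hd1 (1, 0)) (0, 1)
  have hG1 := fderiv_bilinear_comp (u := u) hB hdu (hd1 (0, 1)) (hd1 (1, 0)) (1, 0)
  rw [fderiv_fderiv_apply hd2] at hF1
  rw [fderiv_fderiv_apply hd2, fderiv_fderiv_apply hd2, hsymm] at hG1
  have h1 := hD.fderiv_gChart (f q) (vel₁ f S q) (vel₁ f S q) (vel₂ f I q)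
  have h2 := hD.fderiv_gChart (f q) (vel₂ f I q) (vel₁ f S q) (vel₁ f S q)
  rw [ha, hb] at h1 h2
  have h3 := P.g_symm (f q) (vel₁ f S q) (D (extend E (vel₁ f S q)) (f q) (vel₂ f I q))
  have h4 := P.gChart_symm (f q) (u q) (fderiv ℝ u q (1, 0))
    (fderiv ℝ (fderiv ℝ u) q (0, 1) (1, 0))
  rw [hacc, torsion_eq_extend, g_sub_left, hF'.fderiv_eq, hG'.fderiv_eq, hF1, hG1]
  change _ = _ + _ at h1 h2
  simp only [hu_def, Function.comp_apply] at *
  linarith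

end PseudohermitianManifold

end Maps

/-! ### The first variation formula -/

section FirstVariation

variable {E : Type*} [NormedAddCommGroup E] [NormedSpace ℝ E]
  {M : Type*} [TopologicalSpace M] [ChartedSpace E M]

lemma velocity_of_mem_nhds {γ : ℝ → M} {S : Set ℝ} {t : ℝ} (h : S ∈ 𝓝 t) :
    velocity (E := E) γ S t = mfderiv 𝓘(ℝ, ℝ) 𝓘(ℝ, E) γ t (1 : ℝ) := by
  rw [velocity, mfderivWithin_of_mem_nhds h]

lemma velocity_mono {γ : ℝ → M} {S S' : Set ℝ} {t : ℝ}
    (h : MDifferentiableWithinAt 𝓘(ℝ, ℝ) 𝓘(ℝ, E) γ S' t) (hS : UniqueDiffWithinAt ℝ S t)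
    (hSS' : S ⊆ S') : velocity (E := E) γ S t = velocity γ S' t := by
  rw [velocity, velocity, h.mfderivWithin_mono hS.uniqueMDiffWithinAt hSS']

variable [IsManifold 𝓘(ℝ, E) ∞ M]

lemma accel_congr_set (D : CovariantDerivative 𝓘(ℝ, E) E (TangentSpace 𝓘(ℝ, E) : M → Type _))
    {γ : ℝ → M} {S S' : Set ℝ} {t : ℝ} (h : S ∈ 𝓝 t) (h' : S' ∈ 𝓝 t) :
    accel D γ S t = accel D γ S' t := by
  have hv : ∀ᶠ t' in 𝓝 t, velocity (E := E) γ S t' = velocity γ S' t' := by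
    filter_upwards [eventually_mem_nhds_iff.2 h, eventually_mem_nhds_iff.2 h'] with t' h1 h2
    rw [velocity_of_mem_nhds h1, velocity_of_mem_nhds h2]
  have hd : derivWithin (fun t' ↦ comps (γ t) (γ t') (velocity (E := E) γ S t')) S t
      = derivWithin (fun t' ↦ comps (γ t) (γ t') (velocity (E := E) γ S' t')) S' t := by
    rw [derivWithin_of_mem_nhds h, derivWithin_of_mem_nhds h']
    refine Filter.EventuallyEq.deriv_eq ?_
    filter_upwards [hv] with t' ht'
    rw [ht']
  change constField (γ t) (derivWithin (fun t' ↦ comps (γ t) (γ t') (velocity (E := E) γ S t')) S t) (γ t)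
      + D (extend E (velocity (E := E) γ S t)) (γ t) (velocity (E := E) γ S t)
    = constField (γ t) (derivWithin (fun t' ↦ comps (γ t) (γ t') (velocity (E := E) γ S' t')) S' t) (γ t)
      + D (extend E (velocity (E := E) γ S' t)) (γ t) (velocity (E := E) γ S' t)
  rw [hd, hv.self_of_nhds]

variable [FiniteDimensional ℝ E] [CompleteSpace E] {P : PseudohermitianManifold E M}

namespace PseudohermitianManifold

/-- The integrand of the first variation formula. -/
def variationIntegrand (P : PseudohermitianManifold E M) (D : LinearConnection E M)
    (f : ℝ × ℝ → M) (S I : Set ℝ) (t : ℝ) : ℝ :=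
  P.g (f (t, 0)) (vel₂ f I (t, 0)) (accel D (fun t' ↦ f (t', 0)) S t)
    - P.g (f (t, 0)) (D.torsion (f (t, 0)) (vel₂ f I (t, 0)) (vel₁ f S (t, 0))) (vel₁ f S (t, 0))

/-- Constant speed makes the left side of `half_fderiv_energy` at `s = 0` independent of `t`, so
integrating it in `t` only multiplies by `b - a`. The speed condition is asked at interior `t` only,
so the lemma also applies to each piece of a piecewise smooth variation. -/
lemma IsTanakaWebster.first_variation {D : LinearConnection E M} (hD : P.IsTanakaWebster D)
    {a b ε : ℝ} {f : ℝ × ℝ → M} {c : ℝ → ℝ} (hab : a < b) (hε : 0 < ε)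
    (hf : ContMDiffOn 𝓘(ℝ, ℝ × ℝ) 𝓘(ℝ, E) ∞ f (Icc a b ×ˢ Ioo (-ε) ε))
    (hc0 : ∀ s ∈ Ioo (-ε) ε, 0 ≤ c s)
    (hc : ∀ s ∈ Ioo (-ε) ε, ∀ t ∈ Ioo a b, P.energy f (Icc a b) (t, s) = c s ^ 2)
    (hr : 0 < c 0) :
    ∃ c', HasDerivAt c c' 0 ∧
      IntervalIntegrable (P.variationIntegrand D f (Icc a b) (Ioo (-ε) ε))
        MeasureTheory.volume a b ∧
      (b - a) * (c 0 * c') = P.pairing f (Icc a b) (Ioo (-ε) ε) (b, 0)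
        - P.pairing f (Icc a b) (Ioo (-ε) ε) (a, 0)
        - ∫ t in a..b, P.variationIntegrand D f (Icc a b) (Ioo (-ε) ε) t := by
  set S := Icc a b
  set I := Ioo (-ε) ε
  have hS : UniqueDiffOn ℝ S := uniqueDiffOn_Icc hab
  have hI : UniqueDiffOn ℝ I := isOpen_Ioo.uniqueDiffOn
  have h0 : (0 : ℝ) ∈ I := ⟨by simpa using hε, hε⟩
  have hI0 : I ∈ 𝓝 (0 : ℝ) := isOpen_Ioo.mem_nhds h0
  have hSt : ∀ t ∈ Ioo a b, S ∈ 𝓝 t := fun t ht ↦ Icc_mem_nhds ht.1 ht.2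
  have hen : ∀ t ∈ Ioo a b, HasDerivAt (fun s ↦ P.energy f S (t, s))
      (fderiv ℝ (P.energy f S) (t, 0) (0, 1)) 0 := fun t ht ↦ by
    have h1 : DifferentiableAt ℝ (P.energy f S) (t, 0) :=
      ((P.contDiffOn_energy hf hS hI).contDiffAt (prod_mem_nhds (hSt t ht) hI0)).differentiableAt
        (by simp)
    exact h1.hasFDerivAt.comp_hasDerivAt (0 : ℝ)
      ((hasDerivAt_const (0 : ℝ) t).prodMk (hasDerivAt_id (0 : ℝ)))
  have hc_eq : ∀ t ∈ Ioo a b, (fun s ↦ P.energy f S (t, s)) =ᶠ[𝓝 0] fun s ↦ c s ^ 2 :=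
    fun t ht ↦ by
      filter_upwards [hI0] with s hs using hc s hs t ht
  obtain ⟨t₀, ht₀⟩ : (Ioo a b).Nonempty := nonempty_Ioo.2 hab
  -- Near `s = 0`, `c` is the square root of the smooth energy at one interior parameter `t₀`; `c 0
  -- > 0` keeps the root differentiable.
  obtain ⟨c', hc'⟩ : ∃ c', HasDerivAt c c' 0 := by
    have h1 := (hen t₀ ht₀).sqrt (by rw [hc 0 h0 t₀ ht₀]; positivity)
    refine ⟨_, h1.congr_of_eventuallyEq ?_⟩
    filter_upwards [hI0] with s hs
    rw [hc s hs t₀ ht₀, Real.sqrt_sq (hc0 s hs)]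
  have hK : ∀ t ∈ Ioo a b, (1 / 2) * fderiv ℝ (P.energy f S) (t, 0) (0, 1) = c 0 * c' :=
    fun t ht ↦ by
      have h1 := (hen t ht).unique ((hc'.pow 2).congr_of_eventuallyEq (hc_eq t ht))
      rw [h1]
      ring
  have hpair := P.contDiffOn_pairing hf hS hI
  have hQ : ContDiffOn ℝ 1 (fun t ↦ P.pairing f S I (t, 0)) S :=
    (hpair.comp (contDiff_prodMk_left (0 : ℝ)).contDiffOn fun t ht ↦ ⟨ht, h0⟩).of_le
      ENat.LEInfty.out
  have hderiv : ∀ t ∈ Ioo a b, HasDerivAt (fun t ↦ P.pairing f S I (t, 0))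
      (c 0 * c' + P.variationIntegrand D f S I t) t := fun t ht ↦ by
    have h1 : DifferentiableAt ℝ (P.pairing f S I) (t, 0) :=
      (hpair.contDiffAt (prod_mem_nhds (hSt t ht) hI0)).differentiableAt (by simp)
    have h2 := h1.hasFDerivAt.comp_hasDerivAt t ((hasDerivAt_id t).prodMk (hasDerivAt_const t (0 : ℝ)))
    refine h2.congr_deriv ?_
    have h3 := hD.half_fderiv_energy (q := (t, 0)) hf hS hI (hSt t ht) hI0
    rw [hK t ht] at h3
    rw [h3, variationIntegrand]
    simp
  -- On the open interval the integrand equals the derivative of the pairing minus a constant. The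
  -- derivative within `[a, b]` is continuous up to the end points, whose values do not affect
  -- integrability.
  have hint : IntervalIntegrable (P.variationIntegrand D f S I) MeasureTheory.volume a b := by
    have h1 : ContinuousOn (fun t ↦ derivWithin (fun t ↦ P.pairing f S I (t, 0)) S t - c 0 * c')
        (uIcc a b) := by
      rw [uIcc_of_le hab.le]
      exact (hQ.continuousOn_derivWithin hS le_rfl).sub continuousOn_const
    refine h1.intervalIntegrable.congr_uIoo fun t ht ↦ ?_
    rw [uIoo_of_le hab.le] at ht
    simp only
    rw [derivWithin_of_mem_nhds (hSt t ht), (hderiv t ht).deriv]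
    ring
  refine ⟨c', hc', hint, ?_⟩
  have hftc := intervalIntegral.integral_eq_sub_of_hasDerivAt_of_le hab.le hQ.continuousOn hderiv
    (intervalIntegrable_const.add hint)
  rw [intervalIntegral.integral_add intervalIntegrable_const hint,
    intervalIntegral.integral_const, smul_eq_mul] at hftc
  linarith

/-- Needed because `speed` is defined with `Real.sqrt`, which is `0` on negative numbers: only
nonnegativity makes its square the energy. -/
lemma g_self_nonneg (P : PseudohermitianManifold E M) (x : M) (u : TangentSpace 𝓘(ℝ, E) x) :
    0 ≤ P.g x u u := by
  have h1 : P.g x u u = P.dθ x (u - P.θ x u • P.T x) (P.J x (u - P.θ x u • P.T x))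
      + P.θ x u * P.θ x u := by
    rw [J_sub_smul_T, g]
    simp [dθ, P.T_contract_dθ]
  rw [h1]
  refine add_nonneg ?_ (mul_self_nonneg _)
  by_cases h0 : u - P.θ x u • P.T x = 0
  · rw [h0, map_zero]
    simp
  · exact (P.pos x _ (P.θ_sub_smul_T x u) h0).le

lemma speed_sq (P : PseudohermitianManifold E M) (γ : ℝ → M) (S : Set ℝ) (t : ℝ) :
    P.speed γ S t ^ 2 = P.g (γ t) (velocity γ S t) (velocity γ S t) :=
  Real.sq_sqrt (P.g_self_nonneg _ _)

lemma speed_nonneg (P : PseudohermitianManifold E M) (γ : ℝ → M) (S : Set ℝ) (t : ℝ) :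
    0 ≤ P.speed γ S t := Real.sqrt_nonneg _

lemma IsTanakaWebster.hasDerivAt_length {D : LinearConnection E M} (hD : P.IsTanakaWebster D)
    {a b ε r : ℝ} {γ : ℝ → ℝ → M} {X : Π t : ℝ, TangentSpace 𝓘(ℝ, E) (γ 0 t)}
    (hab : a < b) (hε : 0 < ε) (hr : 0 < r)
    (hf : ContMDiffOn 𝓘(ℝ, ℝ × ℝ) 𝓘(ℝ, E) ∞ (fun q : ℝ × ℝ ↦ γ q.2 q.1)
      (Icc a b ×ˢ Ioo (-ε) ε))
    (hs : ∀ s ∈ Ioo (-ε) ε, ∃ c : ℝ, ∀ t ∈ Icc a b, P.speed (γ s) (Icc a b) t = c)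
    (hs0 : ∀ t ∈ Icc a b, P.speed (γ 0) (Icc a b) t = r)
    (hX : ∀ t ∈ Icc a b, X t = mfderiv 𝓘(ℝ, ℝ) 𝓘(ℝ, E) (fun s ↦ γ s t) 0 (1 : ℝ)) :
    IntervalIntegrable (fun t ↦
        P.g (γ 0 t) (X t) (accel D (γ 0) (Icc a b) t)
          - P.g (γ 0 t) (D.torsion (γ 0 t) (X t) (velocity (γ 0) (Icc a b) t))
              (velocity (γ 0) (Icc a b) t))
      MeasureTheory.volume a b ∧
    HasDerivAt (fun s ↦ P.length (γ s) a b)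
      ((1 / r) *
        (P.g (γ 0 b) (X b) (velocity (γ 0) (Icc a b) b)
          - P.g (γ 0 a) (X a) (velocity (γ 0) (Icc a b) a)
          - ∫ t in a..b,
              (P.g (γ 0 t) (X t) (accel D (γ 0) (Icc a b) t)
                - P.g (γ 0 t) (D.torsion (γ 0 t) (X t) (velocity (γ 0) (Icc a b) t))
                    (velocity (γ 0) (Icc a b) t)))) 0 := by
  have h0 : (0 : ℝ) ∈ Ioo (-ε) ε := ⟨by simpa using hε, hε⟩
  have hI0 : Ioo (-ε) ε ∈ 𝓝 (0 : ℝ) := isOpen_Ioo.mem_nhds h0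
  -- Evaluating the speed at `a` makes a definite function of `s` out of constants given only by
  -- existence.
  set c : ℝ → ℝ := fun s ↦ P.speed (γ s) (Icc a b) a with hc_def
  have ha : a ∈ Icc a b := left_mem_Icc.2 hab.le
  have hb : b ∈ Icc a b := right_mem_Icc.2 hab.le
  have hcs : ∀ s ∈ Ioo (-ε) ε, ∀ t ∈ Icc a b, P.speed (γ s) (Icc a b) t = c s := by
    intro s hs' t ht
    obtain ⟨k, hk⟩ := hs s hs'
    rw [hk t ht]
    exact (hk a ha).symm
  have hc0 : c 0 = r := hs0 a ha
  obtain ⟨c', hc', hint, heq⟩ := hD.first_variation (c := c) hab hε hf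
    (fun s _ ↦ P.speed_nonneg _ _ _)
    (fun s hs' t ht ↦ by rw [← hcs s hs' t (Ioo_subset_Icc_self ht), speed_sq]; rfl)
    (by rw [hc0]; exact hr)
  have hXv : ∀ t ∈ Icc a b, X t = vel₂ (fun q : ℝ × ℝ ↦ γ q.2 q.1) (Ioo (-ε) ε) (t, 0) :=
    fun t ht ↦ (hX t ht).trans (velocity_of_mem_nhds hI0).symm
  have hJ : EqOn (P.variationIntegrand D (fun q : ℝ × ℝ ↦ γ q.2 q.1) (Icc a b) (Ioo (-ε) ε))
      (fun t ↦ P.g (γ 0 t) (X t) (accel D (γ 0) (Icc a b) t)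
          - P.g (γ 0 t) (D.torsion (γ 0 t) (X t) (velocity (γ 0) (Icc a b) t))
              (velocity (γ 0) (Icc a b) t)) (uIcc a b) := by
    intro t ht
    rw [uIcc_of_le hab.le] at ht
    simp only
    rw [hXv t ht]
    rfl
  refine ⟨hint.congr (hJ.mono uIoc_subset_uIcc), ?_⟩
  rw [← intervalIntegral.integral_congr hJ, hXv a ha, hXv b hb]
  have hlen : (fun s ↦ P.length (γ s) a b) =ᶠ[𝓝 0] fun s ↦ (b - a) * c s := by
    filter_upwards [hI0] with s hs'
    rw [length, intervalIntegral.integral_congr (g := fun _ ↦ c s), intervalIntegral.integral_const,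
      smul_eq_mul]
    intro t ht
    rw [uIcc_of_le hab.le] at ht
    exact hcs s hs' t ht
  refine ((hc'.const_mul (b - a)).congr_of_eventuallyEq hlen).congr_deriv ?_
  rw [hc0] at heq
  change _ = (1 / r) * (P.pairing (fun q : ℝ × ℝ ↦ γ q.2 q.1) (Icc a b) (Ioo (-ε) ε) (b, 0)
        - P.pairing (fun q : ℝ × ℝ ↦ γ q.2 q.1) (Icc a b) (Ioo (-ε) ε) (a, 0) - _)
  rw [← heq]
  field_simp

end PseudohermitianManifold

end FirstVariation

/-! ### Partitions of an interval -/

section Partition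

variable {a b t : ℝ} {k : ℕ} {p : Fin (k + 1) → ℝ}

lemma IsPartition.mem_range_or_mem_Ioo (hp : IsPartition a b p) (ht : t ∈ Icc a b) :
    t ∈ range p ∨ ∃ j : Fin k, t ∈ Ioo (p j.castSucc) (p j.succ) := by
  by_contra! h
  obtain ⟨h1, h2⟩ := h
  -- If `t` avoids all nodes and all open gaps, it lies beyond each successive node, hence beyond
  -- `b`.
  have h3 : ∀ i, p i < t := by
    refine Fin.induction ?_ fun i hi ↦ ?_
    · refine lt_of_le_of_ne (hp.1.trans_le ht.1) fun h ↦ h1 ⟨0, h⟩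
    · refine lt_of_le_of_ne (not_lt.1 fun h ↦ h2 i ⟨hi, h⟩) fun h ↦ h1 ⟨_, h⟩
  exact (h3 (Fin.last k)).not_ge (ht.2.trans_eq hp.2.1.symm)

lemma IsPartition.exists_mem_Icc (hp : IsPartition a b p) (hab : a < b) (ht : t ∈ Icc a b) :
    ∃ j : Fin k, t ∈ Icc (p j.castSucc) (p j.succ) := by
  have hlt : ∀ j : Fin k, p j.castSucc ≤ p j.succ := fun j ↦ (hp.2.2 j.castSucc_lt_succ).le
  rcases hp.mem_range_or_mem_Ioo ht with ⟨i, rfl⟩ | ⟨j, hj⟩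
  -- With `k = 0` there are no intervals and `a = b`; this case is where `a < b` is needed.
  · cases k with
    | zero =>
      have h : (0 : Fin 1) = Fin.last 0 := rfl
      exact absurd (hp.1.symm.trans (h ▸ hp.2.1)) hab.ne
    | succ k =>
      induction i using Fin.cases with
      | zero => exact ⟨0, left_mem_Icc.2 (hlt 0)⟩
      | succ j => exact ⟨j, right_mem_Icc.2 (hlt j)⟩
  · exact ⟨j, Ioo_subset_Icc_self hj⟩

lemma IsPartition.Icc_subset (hp : IsPartition a b p) (j : Fin k) :
    Icc (p j.castSucc) (p j.succ) ⊆ Icc a b :=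
  Icc_subset_Icc (hp.1.symm.trans_le (hp.2.2.monotone (Fin.zero_le _)))
    ((hp.2.2.monotone (Fin.le_last _)).trans_eq hp.2.1)

end Partition

/-! ### Lengthy geodesics are critical points in the Sasakian case -/

section Critical

variable {E : Type*} [NormedAddCommGroup E] [NormedSpace ℝ E]
  {M : Type*} [TopologicalSpace M] [ChartedSpace E M]

/-- The velocities lie in the tangent spaces at `γ t` and `γ' t`, equal only propositionally, so
they are compared in the total space. Such comparisons are needed because a variation satisfies `Φ 0
= γ` on `[a, b]` only. -/
lemma mk_velocity_congr {γ γ' : ℝ → M} {S : Set ℝ} {t : ℝ} (h : EqOn γ γ' S) (ht : t ∈ S) :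
    (⟨γ t, velocity γ S t⟩ : TangentBundle 𝓘(ℝ, E) M) = ⟨γ' t, velocity γ' S t⟩ := by
  refine Bundle.TotalSpace.ext (h ht) (@heq_of_eq E _ _ ?_)
  exact congrArg (fun L : ℝ →L[ℝ] E ↦ L 1) (mfderivWithin_congr h (h ht))

variable [IsManifold 𝓘(ℝ, E) ∞ M]

lemma mk_accel_congr (D : CovariantDerivative 𝓘(ℝ, E) E (TangentSpace 𝓘(ℝ, E) : M → Type _))
    {γ γ' : ℝ → M} {S : Set ℝ} {t : ℝ} (h : EqOn γ γ' S) (ht : t ∈ S) :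
    (⟨γ t, accel D γ S t⟩ : TangentBundle 𝓘(ℝ, E) M) = ⟨γ' t, accel D γ' S t⟩ := by
  -- `K` writes the acceleration in terms of the lifted curve in the tangent bundle, so equality of
  -- lifts can be substituted without transport between fibres.
  let K (q : ℝ → TangentBundle 𝓘(ℝ, E) M) (Q : TangentBundle 𝓘(ℝ, E) M) :
      TangentBundle 𝓘(ℝ, E) M :=
    ⟨Q.1, constField Q.1 (derivWithin (fun t' ↦ comps Q.1 (q t').1 (q t').2) S t) Q.1
      + D (extend E Q.2) Q.1 Q.2⟩
  have hK : ∀ q q' : ℝ → TangentBundle 𝓘(ℝ, E) M, EqOn q q' S → K q (q t) = K q' (q' t) := by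
    intro q q' hq
    have h1 : derivWithin (fun t' ↦ comps (q t).1 (q t').1 (q t').2) S t
        = derivWithin (fun t' ↦ comps (q t).1 (q' t').1 (q' t').2) S t :=
      derivWithin_congr (fun t' ht' ↦ by rw [hq ht']) (by rw [← hq ht])
    simp only [K]
    rw [h1, hq ht]
  exact hK (fun t ↦ ⟨γ t, velocity γ S t⟩) (fun t ↦ ⟨γ' t, velocity γ' S t⟩)
    fun t' ht' ↦ mk_velocity_congr h ht'

lemma IsGeodesic.congr {D : CovariantDerivative 𝓘(ℝ, E) E (TangentSpace 𝓘(ℝ, E) : M → Type _)}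
    {γ γ' : ℝ → M} {a b : ℝ} (hγ : IsGeodesic D γ a b) (h : EqOn γ γ' (Icc a b)) :
    IsGeodesic D γ' a b := by
  refine ⟨hγ.1.congr fun t ht ↦ (h ht).symm, fun t ht ↦ ?_⟩
  have h1 := mk_accel_congr D h ht
  rw [hγ.2 t ht] at h1
  exact eq_of_heq ((Bundle.TotalSpace.mk.inj h1).2.symm.trans (@heq_of_eq E 0 0 rfl))

variable [FiniteDimensional ℝ E] [CompleteSpace E]

namespace PseudohermitianManifold

variable {P : PseudohermitianManifold E M}

lemma speed_congr {γ γ' : ℝ → M} {S : Set ℝ} {t : ℝ} (h : EqOn γ γ' S) (ht : t ∈ S) :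
    P.speed γ S t = P.speed γ' S t := by
  have h1 : ∀ Q Q' : TangentBundle 𝓘(ℝ, E) M, Q = Q' →
      P.g Q.proj Q.snd Q.snd = P.g Q'.proj Q'.snd Q'.snd := fun Q Q' h ↦ by rw [h]
  rw [speed, speed]
  exact congrArg Real.sqrt (h1 ⟨γ t, velocity γ S t⟩ ⟨γ' t, velocity γ' S t⟩
    (mk_velocity_congr h ht))

lemma IsLengthy.congr {γ γ' : ℝ → M} {a b : ℝ} (hγ : P.IsLengthy γ a b)
    (h : EqOn γ γ' (Icc a b)) : P.IsLengthy γ' a b := by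
  intro t ht
  have h1 : ∀ Q Q' : TangentBundle 𝓘(ℝ, E) M, Q = Q' → P.θ Q.proj Q.snd = 0 →
      P.θ Q'.proj Q'.snd = 0 := by
    rintro Q _ rfl hQ
    exact hQ
  exact h1 _ _ (mk_velocity_congr h ht) (hγ t ht)

/-- Membership in `Γ` controls velocities within the pieces, whereas `length` uses velocities within
`[a, b]`. They agree off the nodes, and also at the nodes if the curve is differentiable there. -/
lemma IsInΓ.exists_speed {a b : ℝ} {y z : M} {γ : ℝ → M} (hγ : P.IsInΓ a b y z γ) (hab : a < b) :
    ∃ c, 0 ≤ c ∧ (∃ F : Set ℝ, F.Finite ∧ ∀ t ∈ Icc a b, t ∉ F → P.speed γ (Icc a b) t = c) ∧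
      (MDifferentiableOn 𝓘(ℝ, ℝ) 𝓘(ℝ, E) γ (Icc a b) →
        ∀ t ∈ Icc a b, P.speed γ (Icc a b) t = c) := by
  obtain ⟨-, -, k, p, c, hp, h⟩ := hγ
  refine ⟨c, ?_, ⟨range p, finite_range p, fun t ht htp ↦ ?_⟩, fun hγ t ht ↦ ?_⟩
  · obtain ⟨j, hj⟩ := hp.exists_mem_Icc hab (left_mem_Icc.2 hab.le)
    rw [← (h j).2 a hj]
    exact P.speed_nonneg _ _ _
  · obtain ⟨j, hj⟩ := (hp.mem_range_or_mem_Ioo ht).resolve_left htp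
    have h1 : Icc (p j.castSucc) (p j.succ) ∈ 𝓝 t := Icc_mem_nhds hj.1 hj.2
    rw [← (h j).2 t (Ioo_subset_Icc_self hj), speed, speed, velocity_of_mem_nhds h1,
      velocity_of_mem_nhds (mem_of_superset h1 (hp.Icc_subset j))]
  · obtain ⟨j, hj⟩ := hp.exists_mem_Icc hab ht
    rw [← (h j).2 t hj, speed, speed, velocity_mono (hγ t ht)
      (uniqueDiffOn_Icc (hp.2.2 j.castSucc_lt_succ) t hj) (hp.Icc_subset j)]

lemma length_eq_of_speed_eq {γ : ℝ → M} {a b c : ℝ} (hab : a ≤ b) {F : Set ℝ} (hF : F.Finite)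
    (h : ∀ t ∈ Icc a b, t ∉ F → P.speed γ (Icc a b) t = c) : P.length γ a b = (b - a) * c := by
  rw [length, intervalIntegral.integral_congr_ae (g := fun _ ↦ c), intervalIntegral.integral_const,
    smul_eq_mul]
  filter_upwards [hF.countable.ae_notMem MeasureTheory.volume] with t ht ht'
  rw [uIoc_of_le hab] at ht'
  exact h t (Ioc_subset_Icc_self ht') ht

/-- The break points of `Φ s` may depend on `s` and fall inside a rectangle on which the family is
smooth. The energy is continuous in `t` there, so its value off a finite set persists at the
exceptional points. -/
lemma energy_eq_of_speed_eq {Φ : ℝ → ℝ → M} {a b a' b' c s t : ℝ} {I F : Set ℝ}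
    (hf : ContMDiffOn 𝓘(ℝ, ℝ × ℝ) 𝓘(ℝ, E) ∞ (fun q : ℝ × ℝ ↦ Φ q.2 q.1) (Icc a' b' ×ˢ I))
    (hI : IsOpen I) (hs : s ∈ I) (ht : t ∈ Ioo a' b') (hsub : Icc a' b' ⊆ Icc a b)
    (hF : F.Finite) (h : ∀ t ∈ Icc a b, t ∉ F → P.speed (Φ s) (Icc a b) t = c) :
    P.energy (fun q : ℝ × ℝ ↦ Φ q.2 q.1) (Icc a' b') (t, s) = c ^ 2 := by
  have hab : a' < b' := ht.1.trans ht.2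
  have h1 : ContinuousAt (fun t ↦ P.energy (fun q : ℝ × ℝ ↦ Φ q.2 q.1) (Icc a' b') (t, s)) t := by
    have h2 := ((P.contDiffOn_energy hf (uniqueDiffOn_Icc hab) hI.uniqueDiffOn).contDiffAt
      (prod_mem_nhds (Icc_mem_nhds ht.1 ht.2) (hI.mem_nhds hs))).continuousAt
    exact ContinuousAt.comp (f := fun t : ℝ ↦ (t, s)) h2 (by fun_prop)
  refine tendsto_nhds_unique (l := 𝓝[≠] t) (h1.tendsto.mono_left nhdsWithin_le_nhds) ?_
  refine tendsto_const_nhds.congr' ?_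
  have hF' : ∀ᶠ t' in 𝓝[≠] t, t' ∉ F := by
    have := (hF.subset (sdiff_subset (t := {t}))).isClosed.isOpen_compl.mem_nhds
      (show t ∈ (F \ {t})ᶜ by simp)
    filter_upwards [mem_nhdsWithin_of_mem_nhds this, self_mem_nhdsWithin] with t' h1 h2 h3
    exact h1 ⟨h3, h2⟩
  filter_upwards [hF', mem_nhdsWithin_of_mem_nhds (Ioo_mem_nhds ht.1 ht.2)] with t' h2 h3
  have h4 : Icc a' b' ∈ 𝓝 t' := Icc_mem_nhds h3.1 h3.2
  rw [← h t' (hsub (Ioo_subset_Icc_self h3)) h2, speed_sq]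
  rw [velocity_of_mem_nhds (mem_of_superset h4 hsub), ← velocity_of_mem_nhds h4]
  rfl

lemma IsTanakaWebster.variationIntegrand_eq_zero {D : LinearConnection E M}
    (hD : P.IsTanakaWebster D) (hS : P.IsSasakian) {Φ : ℝ → ℝ → M} {a b t : ℝ} {S I : Set ℝ}
    (hl : P.IsLengthy (Φ 0) a b) (hg : IsGeodesic D (Φ 0) a b) (ht : S ∈ 𝓝 t)
    (hsub : S ⊆ Icc a b) : P.variationIntegrand D (fun q : ℝ × ℝ ↦ Φ q.2 q.1) S I t = 0 := by
  have ht' : Icc a b ∈ 𝓝 t := mem_of_superset ht hsub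
  have htm := mem_of_mem_nhds ht'
  have h1 : accel D (Φ 0) S t = 0 := (accel_congr_set D ht ht').trans (hg.2 t htm)
  have h2 : P.θ (Φ 0 t) (velocity (Φ 0) S t) = 0 := by
    rw [velocity_of_mem_nhds ht, ← velocity_of_mem_nhds ht']
    exact hl t htm
  have h3 := hD.g_torsion_horizontal hS (vel₂ (fun q : ℝ × ℝ ↦ Φ q.2 q.1) I (t, 0)) h2
  change P.g (Φ 0 t) _ (accel D (Φ 0) S t) - P.g (Φ 0 t) (D.torsion (Φ 0 t) _
    (velocity (Φ 0) S t)) (velocity (Φ 0) S t) = 0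
  rw [h1, h3]
  simp [g]

lemma IsTanakaWebster.isCriticalPoint {D : LinearConnection E M} (hD : P.IsTanakaWebster D)
    (hS : P.IsSasakian) {a b : ℝ} {y z : M} {γ : ℝ → M} (hab : a < b)
    (hl : P.IsLengthy γ a b) (hg : IsGeodesic D γ a b)
    (hne : ∃ t ∈ Icc a b, P.speed γ (Icc a b) t ≠ 0) : P.IsCriticalPoint a b y z γ := by
  rintro ε Φ ⟨hε, hmem, hbase, k, p, hp, hsm⟩
  have hbase' : EqOn γ (Φ 0) (Icc a b) := fun t ht ↦ (hbase t ht).symm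
  replace hl := hl.congr hbase'
  replace hg := hg.congr hbase'
  set I := Ioo (-ε) ε
  have h0 : (0 : ℝ) ∈ I := ⟨by simpa using hε, hε⟩
  have hI : IsOpen I := isOpen_Ioo
  have hI0 : I ∈ 𝓝 (0 : ℝ) := hI.mem_nhds h0
  have hdiff : MDifferentiableOn 𝓘(ℝ, ℝ) 𝓘(ℝ, E) (Φ 0) (Icc a b) :=
    hg.1.mdifferentiableOn (by norm_num)
  -- The values of `c` outside `I` are arbitrary; only those near `0` enter the derivative.
  choose! c hc0 hcF hcS using fun s (hs : s ∈ I) ↦ (hmem s hs).exists_speed hab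
  choose! F hF hcF using hcF
  have hr : 0 < c 0 := by
    obtain ⟨t, ht, hne⟩ := hne
    rw [speed_congr hbase' ht, hcS 0 h0 hdiff t ht] at hne
    exact lt_of_le_of_ne (hc0 0 h0) hne.symm
  set f : ℝ × ℝ → M := fun q ↦ Φ q.2 q.1 with hf_def
  have hpiece : ∀ j : Fin k, ∃ c', HasDerivAt c c' 0 ∧
      (p j.succ - p j.castSucc) * (c 0 * c')
        = P.g (Φ 0 (p j.succ)) (vel₂ f I (p j.succ, 0)) (velocity (Φ 0) (Icc a b) (p j.succ))
        - P.g (Φ 0 (p j.castSucc)) (vel₂ f I (p j.castSucc, 0))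
            (velocity (Φ 0) (Icc a b) (p j.castSucc)) := by
    intro j
    have hlt : p j.castSucc < p j.succ := hp.2.2 j.castSucc_lt_succ
    have hsub := hp.Icc_subset j
    obtain ⟨c', hc', -, h⟩ := hD.first_variation (c := c) hlt hε (hsm j) hc0
      (fun s hs t ht ↦ energy_eq_of_speed_eq (hsm j) hI hs ht hsub (hF s hs) (hcF s hs)) hr
    refine ⟨c', hc', ?_⟩
    have hz : ∫ t in p j.castSucc..p j.succ, P.variationIntegrand D f
        (Icc (p j.castSucc) (p j.succ)) I t = 0 := by
      rw [intervalIntegral.integral_congr_Ioo_of_le (g := fun _ ↦ 0) hlt.le,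
        intervalIntegral.integral_zero]
      exact fun t ht ↦ hD.variationIntegrand_eq_zero hS hl hg (Icc_mem_nhds ht.1 ht.2) hsub
    -- Since the geodesic is differentiable on all of `[a, b]`, the one-sided velocities at a node
    -- equal its velocity within `[a, b]`; this is what lets neighbouring boundary terms cancel.
    have hv : ∀ t ∈ Icc (p j.castSucc) (p j.succ),
        P.pairing f (Icc (p j.castSucc) (p j.succ)) I (t, 0)
          = P.g (Φ 0 t) (vel₂ f I (t, 0)) (velocity (E := E) (Φ 0) (Icc a b) t) := fun t ht ↦
      congrArg (P.g (Φ 0 t) (vel₂ f I (t, 0)))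
        (velocity_mono (hdiff t (hsub ht)) (uniqueDiffOn_Icc hlt t ht) hsub)
    rw [h, hz, sub_zero, hv _ (right_mem_Icc.2 hlt.le), hv _ (left_mem_Icc.2 hlt.le)]
  obtain ⟨j₀, -⟩ := hp.exists_mem_Icc hab (left_mem_Icc.2 hab.le)
  obtain ⟨c', hc', -⟩ := hpiece j₀
  -- Telescoping over the pieces: `c'` is the same on each of them by uniqueness of the derivative
  -- of `c`.
  have htel : ∀ i, (p i - a) * (c 0 * c')
      = P.g (Φ 0 (p i)) (vel₂ f I (p i, 0)) (velocity (Φ 0) (Icc a b) (p i))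
        - P.g (Φ 0 (p 0)) (vel₂ f I (p 0, 0)) (velocity (Φ 0) (Icc a b) (p 0)) := by
    refine Fin.induction ?_ fun i hi ↦ ?_
    · rw [hp.1]
      ring
    · obtain ⟨c₁, hc₁, h⟩ := hpiece i
      rw [hc₁.unique hc'] at h
      linarith
  -- Applied at `t = a` and `t = b`, where all the curves share the points `y` and `z`.
  have hconst : ∀ (t : ℝ) (x : M), (∀ s ∈ I, Φ s t = x) → vel₂ (E := E) f I (t, 0) = 0 := by
    intro t x h
    have h1 : mfderivWithin 𝓘(ℝ, ℝ) 𝓘(ℝ, E) (fun s ↦ Φ s t) I 0 = _ :=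
      mfderivWithin_congr (f := fun _ ↦ x) h (h 0 h0)
    rw [mfderivWithin_const] at h1
    exact congrArg (fun L : ℝ →L[ℝ] E ↦ L 1) h1
  have hlast := htel (Fin.last k)
  rw [hp.1, hp.2.1, hconst a y fun s hs ↦ (hmem s hs).1,
    hconst b z fun s hs ↦ (hmem s hs).2.1] at hlast
  have hc'0 : c' = 0 := by
    simp only [g, map_zero, zero_apply, zero_mul, add_zero, sub_zero,
      mul_eq_zero, sub_eq_zero] at hlast
    rcases hlast with h | h | h
    · exact absurd h hab.ne'
    · exact absurd h hr.ne'
    · exact h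
  rw [hc'0] at hc'
  have hlen : (fun s ↦ P.length (Φ s) a b) =ᶠ[𝓝 0] fun s ↦ (b - a) * c s := by
    filter_upwards [hI0] with s hs using length_eq_of_speed_eq hab.le (hF s hs) (hcF s hs)
  exact ((hc'.const_mul (b - a)).congr_of_eventuallyEq hlen).congr_deriv (mul_zero _)

end PseudohermitianManifold

end Critical

end CR

end

open CR CR.PseudohermitianManifold in
theorem theoremt (n : ℕ) {M : Type*} [TopologicalSpace M] [T2Space M]
    [ChartedSpace (EuclideanSpace ℝ (Fin (2 * n + 1))) M] [IsManifold (𝓡 (2 * n + 1)) ∞ M]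
    (P : PseudohermitianManifold (EuclideanSpace ℝ (Fin (2 * n + 1))) M)
    (D : LinearConnection (EuclideanSpace ℝ (Fin (2 * n + 1))) M)
    (hD : P.IsTanakaWebster D) :
    (∀ (a b ε r : ℝ) (γ : ℝ → ℝ → M) (X : Π t : ℝ, TangentSpace (𝓡 (2 * n + 1)) (γ 0 t)),
      a < b → 0 < ε → 0 < r →
      ContMDiffOn 𝓘(ℝ, ℝ × ℝ) (𝓡 (2 * n + 1)) ∞ (fun q : ℝ × ℝ ↦ γ q.2 q.1)
        (Icc a b ×ˢ Ioo (-ε) ε) →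
      (∀ s ∈ Ioo (-ε) ε, ∃ c : ℝ, ∀ t ∈ Icc a b, P.speed (γ s) (Icc a b) t = c) →
      (∀ t ∈ Icc a b, P.speed (γ 0) (Icc a b) t = r) →
      (∀ t ∈ Icc a b, X t = mfderiv 𝓘(ℝ, ℝ) (𝓡 (2 * n + 1)) (fun s ↦ γ s t) 0 (1 : ℝ)) →
      IntervalIntegrable (fun t ↦
          P.g (γ 0 t) (X t) (accel D (γ 0) (Icc a b) t)
            - P.g (γ 0 t) (D.torsion (γ 0 t) (X t) (velocity (γ 0) (Icc a b) t))
                (velocity (γ 0) (Icc a b) t))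
        MeasureTheory.volume a b ∧
      HasDerivAt (fun s ↦ P.length (γ s) a b)
        ((1 / r) *
          (P.g (γ 0 b) (X b) (velocity (γ 0) (Icc a b) b)
            - P.g (γ 0 a) (X a) (velocity (γ 0) (Icc a b) a)
            - ∫ t in a..b,
                (P.g (γ 0 t) (X t) (accel D (γ 0) (Icc a b) t)
                  - P.g (γ 0 t) (D.torsion (γ 0 t) (X t) (velocity (γ 0) (Icc a b) t))
                      (velocity (γ 0) (Icc a b) t)))) 0) ∧
    (P.IsSasakian →
      ∀ (a b : ℝ) (y z : M) (γ : ℝ → M), a < b → P.IsInΓ a b y z γ →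
        P.IsLengthy γ a b → IsGeodesic D γ a b →
        (∃ t ∈ Icc a b, P.speed γ (Icc a b) t ≠ 0) →
        P.IsCriticalPoint a b y z γ) :=
  ⟨fun _ _ _ _ _ _ hab hε hr hf hs hs0 hX ↦ hD.hasDerivAt_length hab hε hr hf hs hs0 hX,
    fun hS _ _ _ _ _ hab _ hl hg hne ↦ hD.isCriticalPoint hS hab hl hg hne⟩
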